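/- A (strictly) stationary real-valued time series $(X_t)_{t\in\mathbb Z}$ is one whose finite-dimensional distributions are invariant under time shifts. A Gaussian process is understood to be non-singular: all its finite-dimensional distributions are multivariate Gaussian with invertible covariance matrix (and hence have joint densities). Let $(C_k)_{k\ge 1}$ be bivariate copulas that are $C^\infty$ on $(0,1)^2$ with densities $c_k=\partial^2 C_k/\partial u_1\partial u_2>0$ on $(0,1)^2$, and let $h^{(i)}_k=\partial C_k/\partial u_i$. Define $R^{(1)}_0(\cdot,x)=R^{(2)}_0(\cdot,x)=x$ and, for $k\ge 1$, $\boldsymbol u=(u_1,\dots,u_k)\in(0,1)^k$ and $x\in(0,1)$, $$R^{(1)}_k(\boldsymbol u,x)=h^{(1)}_k\big(R^{(2)}_{k-1}(\boldsymbol u_{-1},u_1),\,R^{(1)}_{k-1}(\boldsymbol u_{-1},x)\big),\qquad R^{(2)}_k(\boldsymbol u,x)=h^{(2)}_k\big(R^{(2)}_{k-1}(\boldsymbol u_{-k},x),\,R^{(1)}_{k-1}(\boldsymbol u_{-k},u_k)\big),$$ where $\boldsymbol u_{-i}$ is $\boldsymbol u$ with its $i$th component removed. A strictly stationary time series $(X_t)_{t\in\mathbb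 Z}$ is an s-vine process with pair copulas $(C_k)_{k\ge1}$ if for every $t\in\mathbb Z$ and $n\ge 2$ the distribution of $(X_t,\dots,X_{t+n-1})$ is absolutely continuous and its unique copula has on $(0,1)^n$ the density $$c_{(n)}(u_1,\dots,u_n)=\prod_{k=1}^{n-1}\prod_{j=k+1}^{n}c_k\Big(R^{(2)}_{k-1}\big((u_{j-k+1},\dots,u_{j-1}),u_{j-k}\big),\,R^{(1)}_{k-1}\big((u_{j-k+1},\dots,u_{j-1}),u_j\big)\Big).$$ It is an s-vine process if it is one for some such sequence $(C_k)_{k\ge1}$. A bivariate copula is Gaussian if it is the copula of a bivariate Gaussian distribution with some correlation $\alpha\in(-1,1)$. Proposition. (1) Every stationary Gaussian process $(X_t)_{t\in\mathbb Z}$ is an s-vine process. (2) Every s-vine process whose pair copulas $C_k$, $k\ge1$, are all Gaussian and whose univariate marginal distribution is Gaussian is a Gaussian process. -/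

import Mathlib

open MeasureTheory ProbabilityTheory

/-- An `n`-dimensional copula: a probability law on `ℝⁿ` all of whose univariate margins are
uniform on `[0,1]`. -/
structure Copula (n : ℕ) where
  law : Measure (Fin n → ℝ)
  isProbabilityMeasure : IsProbabilityMeasure law
  uniform_margins : ∀ i, law.map (fun u => u i) = volume.restrict (Set.Icc (0 : ℝ) 1)

namespace Copula

/-- The copula as a function: the joint distribution function of its law. -/
noncomputable def df {n : ℕ} (C : Copula n) (u : Fin n → ℝ) : ℝ :=
  C.law.real (Set.Iic u)

/-- `C` is a copula of the law `ν` on `ℝⁿ`, i.e.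
`ν(y₁ ≤ x₁, …, yₙ ≤ xₙ) = C(F₁(x₁), …, Fₙ(xₙ))` for all `x`, with `Fᵢ` the marginal distribution
functions of `ν`. -/
def IsCopulaOf {n : ℕ} (C : Copula n) (ν : Measure (Fin n → ℝ)) : Prop :=
  ∀ x : Fin n → ℝ, ν.real (Set.Iic x) = C.df (fun i => cdf (ν.map (fun y => y i)) (x i))

/-- `C` has joint density `c` on `(0,1)ⁿ`. -/
def HasDensity {n : ℕ} (C : Copula n) (c : (Fin n → ℝ) → ℝ) : Prop :=
  C.law = (volume.restrict (Set.univ.pi fun _ => Set.Ioo (0 : ℝ) 1)).withDensity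
    (fun u => ENNReal.ofReal (c u))

/-- First partial derivative `∂C/∂u₁` of a bivariate copula. -/
noncomputable def h₁ (C : Copula 2) (u v : ℝ) : ℝ := deriv (fun s => C.df ![s, v]) u

/-- Second partial derivative `∂C/∂u₂` of a bivariate copula. -/
noncomputable def h₂ (C : Copula 2) (u v : ℝ) : ℝ := deriv (fun s => C.df ![u, s]) v

/-- Density `∂²C/∂u₁∂u₂` of a bivariate copula. -/
noncomputable def density (C : Copula 2) (u v : ℝ) : ℝ := deriv (fun s => C.h₂ s v) u

/-- A bivariate copula that is smooth on `(0,1)²` with strictly positive density there. -/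
structure IsSmoothPositive (C : Copula 2) : Prop where
  contDiffOn : ContDiffOn ℝ (⊤ : ℕ∞) (fun p : ℝ × ℝ => C.df ![p.1, p.2])
    (Set.Ioo (0 : ℝ) 1 ×ˢ Set.Ioo (0 : ℝ) 1)
  density_pos : ∀ u ∈ Set.Ioo (0 : ℝ) 1, ∀ v ∈ Set.Ioo (0 : ℝ) 1, 0 < C.density u v

/-- `C` is a Gaussian pair copula: for some `α ∈ (-1,1)` it is the copula of the centred bivariate
Gaussian law with unit variances and correlation `α`. -/
def IsGaussian (C : Copula 2) : Prop :=
  ∃ α ∈ Set.Ioo (-1 : ℝ) 1,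
    C.IsCopulaOf ((multivariateGaussian 0 !![1, α; α, 1]).map
      (fun z : EuclideanSpace ℝ (Fin 2) => fun i => z i))

end Copula

/-- The pair `(R⁽¹⁾ₖ(u, x), R⁽²⁾ₖ(u, x))` of forward and backward Rosenblatt functions of a sequence
of bivariate copulas; `C k` is the copula at lag `k`, and `C 0` is never used. -/
noncomputable def rosenblatt (C : ℕ → Copula 2) : (k : ℕ) → (Fin k → ℝ) → ℝ → ℝ × ℝ
  | 0, _, x => (x, x)
  | k + 1, u, x =>
    ((C (k + 1)).h₁ (rosenblatt C k (Fin.tail u) (u 0)).2 (rosenblatt C k (Fin.tail u) x).1,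
     (C (k + 1)).h₂ (rosenblatt C k (Fin.init u) x).2
      (rosenblatt C k (Fin.init u) (u (Fin.last k))).1)

/-- The forward Rosenblatt function `R⁽¹⁾ₖ`. -/
noncomputable def forwardRosenblatt (C : ℕ → Copula 2) (k : ℕ) (u : Fin k → ℝ) (x : ℝ) : ℝ :=
  (rosenblatt C k u x).1

/-- The backward Rosenblatt function `R⁽²⁾ₖ`. -/
noncomputable def backwardRosenblatt (C : ℕ → Copula 2) (k : ℕ) (u : Fin k → ℝ) (x : ℝ) : ℝ :=
  (rosenblatt C k u x).2

/-- The s-vine copula density (simplified, translation-invariant d-vine)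
`∏_{k=1}^{n-1} ∏_{j=k+1}^{n}
  cₖ(R⁽²⁾ₖ₋₁(u_{j-k+1},…,u_{j-1}; u_{j-k}), R⁽¹⁾ₖ₋₁(u_{j-k+1},…,u_{j-1}; u_j))`.
The loop variable `k` below is the lag minus one, and `i` is the zero-based position of the first
member of the pair, so that the pair sits at the positions `i` and `i + k + 1`. -/
noncomputable def sVineDensity (C : ℕ → Copula 2) (n : ℕ) (u : Fin n → ℝ) : ℝ :=
  ∏ k : Fin (n - 1), ∏ i : Fin (n - 1 - k),
    (C (k + 1)).density
      (backwardRosenblatt C k (fun m => u ⟨i + 1 + m, by omega⟩) (u ⟨i, by omega⟩))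
      (forwardRosenblatt C k (fun m => u ⟨i + 1 + m, by omega⟩) (u ⟨i + k + 1, by omega⟩))

section Processes

variable {Ω : Type*} [MeasurableSpace Ω]

/-- Strict stationarity: the finite-dimensional distributions are invariant under time shifts. -/
def IsStrictlyStationary (X : ℤ → Ω → ℝ) (P : Measure Ω) : Prop :=
  ∀ (n : ℕ) (t : Fin n → ℤ) (h : ℤ),
    IdentDistrib (fun ω i => X (t i + h) ω) (fun ω i => X (t i) ω) P P

/-- The law of `(X_t, …, X_{t+n-1})`. -/
noncomputable def windowLaw (X : ℤ → Ω → ℝ) (P : Measure Ω) (t : ℤ) (n : ℕ) :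
    Measure (Fin n → ℝ) :=
  P.map (fun ω i => X (t + (i : ℕ)) ω)

/-- `X` is an s-vine process with pair copulas `C 1, C 2, …`: it is strictly stationary, the pair
copulas are smooth with positive densities, and for all `t` and `n ≥ 2` the law of
`(X_t, …, X_{t+n-1})` is absolutely continuous and has a unique copula, whose density is the
s-vine density. -/
structure IsSVineProcessWith (X : ℤ → Ω → ℝ) (P : Measure Ω) (C : ℕ → Copula 2) : Prop where
  stationary : IsStrictlyStationary X P
  smoothPositive : ∀ k, 1 ≤ k → (C k).IsSmoothPositive
  absolutelyContinuous : ∀ (t : ℤ) (n : ℕ), 2 ≤ n → windowLaw X P t n ≪ volume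
  copula : ∀ (t : ℤ) (n : ℕ), 2 ≤ n →
    ∃ D : Copula n, D.IsCopulaOf (windowLaw X P t n) ∧
      (∀ D' : Copula n, D'.IsCopulaOf (windowLaw X P t n) → D' = D) ∧
      D.HasDensity (sVineDensity C n)

/-- `X` is an s-vine process. -/
def IsSVineProcess (X : ℤ → Ω → ℝ) (P : Measure Ω) : Prop :=
  ∃ C : ℕ → Copula 2, IsSVineProcessWith X P C

/-- A non-singular Gaussian process: all finite-dimensional distributions are Gaussian with
invertible covariance matrix, and have a density. -/
structure IsNonsingularGaussianProcess (X : ℤ → Ω → ℝ) (P : Measure Ω) : Prop where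
  isGaussianProcess : IsGaussianProcess X P
  isUnit_covariance : ∀ I : Finset ℤ, IsUnit (Matrix.of fun s t : I => cov[X s, X t; P])
  absolutelyContinuous : ∀ I : Finset ℤ, P.map (fun ω => I.restrict (X · ω)) ≪ volume

end Processes

/-! Everything is moved to normal scores `z = Φ⁻¹(u)`. There the `h`-functions of a Gaussian pair
copula with correlation `α` are affine, `(y - α x) / √(1 - α²)`, so the Rosenblatt recursion becomes
the normalized lattice recursion of linear prediction (`rosenblatt_stdCDF`): `R⁽¹⁾ₖ` and `R⁽²⁾ₖ`
turn into `Φ` of the forward and backward errors of order `k`. Each pair density is `φ(new forward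
error) / (√(1 - α²) φ(old forward error))`. Grouped by the later member of the pair, the vine
product therefore telescopes (`prod_density_eq_div`, `sVineDensity_stdCDFPi`). The errors of full
order are `M z` with `M` lower triangular with positive diagonal, and the s-vine density in normal
scores is `det M ∏ φ((M z)ⱼ) / φ(zⱼ)`. Hence a law has this density relative to the standard normal
law iff `M` maps it to the standard normal law (`eq_withDensity_sVineDensity_iff`). For (2), the
standardized window is then `M⁻¹` applied to a standard normal vector, hence Gaussian;
nonsingularity follows from absolute continuity. For (1), the coefficients are taken to be the
partial autocorrelations of the process. A Levinson–Durbin argument in `L²`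
(`latticeFilter_orthogonal`) shows that they lie in `(-1,1)` and that the errors of full order are
orthonormal; being jointly Gaussian they form a standard normal vector, so `M` whitens every window
and the Gaussian pair copulas with these correlations work. -/

/-! ### The standard normal distribution function. -/

/-- The density of the standard normal law. -/
noncomputable def stdPDF (x : ℝ) : ℝ := gaussianPDFReal 0 1 x

/-- The distribution function of the standard normal law. -/
noncomputable def stdCDF (x : ℝ) : ℝ := cdf (gaussianReal 0 1) x

theorem stdPDF_eq (x : ℝ) : stdPDF x = (√(2 * Real.pi))⁻¹ * Real.exp (-x ^ 2 / 2) := by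
  simp [stdPDF, gaussianPDFReal]

theorem stdPDF_pos (x : ℝ) : 0 < stdPDF x := gaussianPDFReal_pos _ _ _ one_ne_zero

theorem contDiff_stdPDF {n : WithTop ℕ∞} : ContDiff ℝ n stdPDF := by
  have : stdPDF = fun x => (√(2 * Real.pi))⁻¹ * Real.exp (-x ^ 2 / 2) := funext stdPDF_eq
  rw [this]; fun_prop

theorem continuous_stdPDF : Continuous stdPDF := (contDiff_stdPDF (n := 0)).continuous

theorem integrable_stdPDF : Integrable stdPDF := integrable_gaussianPDFReal 0 1

theorem hasDerivAt_setIntegral_Iic {f : ℝ → ℝ} (hf : Integrable f) (hc : Continuous f) (x : ℝ) :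
    HasDerivAt (fun x => ∫ t in Set.Iic x, f t) (f x) x := by
  have h : (fun x => ∫ t in Set.Iic x, f t) =
      fun x => (∫ t in Set.Iic 0, f t) + ∫ t in (0 : ℝ)..x, f t := by
    funext y
    rw [← intervalIntegral.integral_Iic_sub_Iic hf.integrableOn hf.integrableOn]; ring
  rw [h]
  exact (intervalIntegral.integral_hasDerivAt_right hf.intervalIntegrable
    (hc.stronglyMeasurableAtFilter _ _) hc.continuousAt).const_add _

theorem stdCDF_eq_integral (x : ℝ) : stdCDF x = ∫ t in Set.Iic x, stdPDF t := by
  rw [stdCDF, cdf_eq_real, measureReal_def, gaussianReal_apply_eq_integral _ one_ne_zero,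
    ENNReal.toReal_ofReal]
  · rfl
  · exact integral_nonneg fun t => (stdPDF_pos t).le

theorem hasDerivAt_stdCDF (x : ℝ) : HasDerivAt stdCDF (stdPDF x) x := by
  rw [funext stdCDF_eq_integral]
  exact hasDerivAt_setIntegral_Iic integrable_stdPDF continuous_stdPDF x

theorem deriv_stdCDF : deriv stdCDF = stdPDF := funext fun x => (hasDerivAt_stdCDF x).deriv

theorem strictMono_stdCDF : StrictMono stdCDF :=
  strictMono_of_deriv_pos fun x => by rw [deriv_stdCDF]; exact stdPDF_pos x

theorem contDiff_stdCDF : ContDiff ℝ (⊤ : ℕ∞) stdCDF := by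
  rw [contDiff_infty_iff_deriv, deriv_stdCDF]
  exact ⟨fun x => (hasDerivAt_stdCDF x).differentiableAt, contDiff_stdPDF⟩

theorem continuous_stdCDF : Continuous stdCDF := contDiff_stdCDF.continuous

theorem stdCDF_mem_Ioo (x : ℝ) : stdCDF x ∈ Set.Ioo (0 : ℝ) 1 :=
  ⟨(cdf_nonneg _ (x - 1)).trans_lt (strictMono_stdCDF (by linarith)),
    (strictMono_stdCDF (by linarith : x < x + 1)).trans_le (cdf_le_one _ _)⟩

theorem range_stdCDF : Set.range stdCDF = Set.Ioo 0 1 := by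
  refine Set.Subset.antisymm (Set.range_subset_iff.2 stdCDF_mem_Ioo) fun u hu => ?_
  exact mem_range_of_exists_le_of_exists_ge continuous_stdCDF
    ((((tendsto_cdf_atBot (gaussianReal 0 1)).eventually_lt_const hu.1).exists).imp
      fun _ h => h.le)
    ((((tendsto_cdf_atTop (gaussianReal 0 1)).eventually_const_lt hu.2).exists).imp
      fun _ h => h.le)

/-- Probability integral transform, checked on half-lines; thresholds outside `(0,1)` are separate
because `Φ` does not attain them. -/
theorem map_stdCDF_gaussianReal :
    (gaussianReal 0 1).map stdCDF = volume.restrict (Set.Icc (0 : ℝ) 1) := by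
  have := Measure.isProbabilityMeasure_map (μ := gaussianReal 0 1)
    continuous_stdCDF.measurable.aemeasurable
  refine Measure.ext_of_Iic _ _ fun a => ?_
  rw [Measure.map_apply continuous_stdCDF.measurable measurableSet_Iic,
    Measure.restrict_apply measurableSet_Iic]
  rcases le_or_gt a 0 with ha | ha
  · have h1 : stdCDF ⁻¹' Set.Iic a = ∅ := by
      ext x; simpa using ha.trans_lt (stdCDF_mem_Ioo x).1
    have h2 : Set.Iic a ∩ Set.Icc (0 : ℝ) 1 ⊆ {0} := fun x hx =>
      le_antisymm (hx.1.trans ha) hx.2.1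
    rw [h1, measure_empty, measure_mono_null h2 (by simp)]
  rcases le_or_gt 1 a with ha1 | ha1
  · have h1 : stdCDF ⁻¹' Set.Iic a = Set.univ := by
      ext x; simpa using (stdCDF_mem_Ioo x).2.le.trans ha1
    have h2 : Set.Iic a ∩ Set.Icc (0 : ℝ) 1 = Set.Icc 0 1 :=
      Set.inter_eq_right.2 fun x hx => hx.2.trans ha1
    rw [h1, h2]; simp
  · obtain ⟨y, rfl⟩ : a ∈ Set.range stdCDF := range_stdCDF ▸ ⟨ha, ha1⟩
    have h1 : stdCDF ⁻¹' Set.Iic (stdCDF y) = Set.Iic y := by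
      ext x; simp [strictMono_stdCDF.le_iff_le]
    have h2 : Set.Iic (stdCDF y) ∩ Set.Icc (0 : ℝ) 1 = Set.Icc 0 (stdCDF y) := by
      ext x; simp only [Set.mem_inter_iff, Set.mem_Iic, Set.mem_Icc]
      constructor
      · tauto
      · exact fun h => ⟨h.2, h.1, h.2.trans ha1.le⟩
    rw [h1, h2, Real.volume_Icc, sub_zero, ← ofReal_cdf, stdCDF]

/-! ### Copulas in normal scores. -/

/-- The coordinatewise application of the standard normal distribution function. -/
noncomputable def stdCDFPi {ι : Type*} (z : ι → ℝ) (i : ι) : ℝ := stdCDF (z i)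

theorem measurable_stdCDFPi {ι : Type*} : Measurable (stdCDFPi : (ι → ℝ) → ι → ℝ) :=
  measurable_pi_lambda _ fun i => continuous_stdCDF.measurable.comp (measurable_pi_apply i)

theorem injective_stdCDFPi {ι : Type*} : Function.Injective (stdCDFPi : (ι → ℝ) → ι → ℝ) :=
  fun _ _ h => funext fun i => strictMono_stdCDF.injective (congrFun h i)

theorem preimage_stdCDFPi_Iic {ι : Type*} (z : ι → ℝ) :
    stdCDFPi ⁻¹' Set.Iic (stdCDFPi z) = Set.Iic z := by
  ext x; simp [Pi.le_def, stdCDFPi, strictMono_stdCDF.le_iff_le]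

theorem measurableEmbedding_stdCDFPi {n : ℕ} :
    MeasurableEmbedding (stdCDFPi : (Fin n → ℝ) → Fin n → ℝ) :=
  measurable_stdCDFPi.measurableEmbedding injective_stdCDFPi

theorem range_stdCDFPi {ι : Type*} :
    Set.range (stdCDFPi : (ι → ℝ) → ι → ℝ) = Set.univ.pi fun _ => Set.Ioo 0 1 := by
  ext u
  simp only [Set.mem_range, Set.mem_univ_pi, ← range_stdCDF]
  constructor
  · rintro ⟨z, rfl⟩ i; exact ⟨z i, rfl⟩
  · intro h; choose z hz using h; exact ⟨z, funext hz⟩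

/-- The standard normal law on `ℝⁿ`. -/
noncomputable abbrev stdNormal (n : ℕ) : Measure (Fin n → ℝ) :=
  Measure.pi fun _ => gaussianReal 0 1

theorem map_stdCDFPi_stdNormal (n : ℕ) :
    (stdNormal n).map stdCDFPi = volume.restrict (Set.univ.pi fun _ => Set.Ioo (0 : ℝ) 1) := by
  have h := Measure.pi_map_pi (μ := fun _ : Fin n => gaussianReal 0 1) (f := fun _ => stdCDF)
    (hμ := fun _ => by rw [map_stdCDF_gaussianReal]; infer_instance)
    (fun _ => continuous_stdCDF.measurable.aemeasurable)
  rw [map_stdCDF_gaussianReal, ← Measure.restrict_congr_set Ioo_ae_eq_Icc,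
    ← Measure.restrict_pi_pi] at h
  exact h

theorem MeasurableEmbedding.withDensity_map {α β : Type*} [MeasurableSpace α]
    [MeasurableSpace β] {e : α → β} (he : MeasurableEmbedding e) (μ : Measure α)
    (f : β → ENNReal) : (μ.map e).withDensity f = (μ.withDensity (f ∘ e)).map e := by
  ext s hs
  rw [withDensity_apply _ hs, he.map_apply, withDensity_apply _ (he.measurable hs),
    he.restrict_map, he.lintegral_map]
  rfl

/-- Lebesgue measure on the open cube is the image of the standard normal law under `Φ`, so a copula
density is also a density relative to that law in normal scores. -/
theorem Copula.hasDensity_iff {n : ℕ} (D : Copula n) (c : (Fin n → ℝ) → ℝ) :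
    D.HasDensity c ↔
      D.law = ((stdNormal n).withDensity fun z => ENNReal.ofReal (c (stdCDFPi z))).map stdCDFPi := by
  rw [Copula.HasDensity, ← map_stdCDFPi_stdNormal, measurableEmbedding_stdCDFPi.withDensity_map]
  rfl

theorem ext_of_Iic_pi {n : ℕ} {μ ν : Measure (Fin n → ℝ)} [IsProbabilityMeasure μ]
    [IsProbabilityMeasure ν] (h : ∀ x, μ (Set.Iic x) = ν (Set.Iic x)) : μ = ν := by
  refine ext_of_generate_finite
    (Set.univ.pi '' Set.univ.pi fun _ : Fin n => Set.range (Set.Iic : ℝ → Set ℝ))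
    (generateFrom_eq_pi (fun _ => (borel_eq_generateFrom_Iic ℝ).symm.trans
      (BorelSpace.measurable_eq (α := ℝ)).symm) fun _ => ?_).symm
    (IsPiSystem.pi fun _ => isPiSystem_Iic) ?_ (by simp)
  · refine ⟨fun k : ℕ => Set.Iic (k : ℝ), fun k => ⟨k, rfl⟩, ?_⟩
    rw [Set.iUnion_eq_univ_iff]
    exact fun x => (exists_nat_ge x).imp fun k hk => hk
  · rintro _ ⟨s, hs, rfl⟩
    choose x hx using fun i => hs i (Set.mem_univ i)
    have : Set.univ.pi s = Set.Iic x := by rw [← Set.pi_univ_Iic]; simp [hx]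
    rw [this, h]

attribute [instance] Copula.isProbabilityMeasure

theorem Copula.ae_mem_Ioo {n : ℕ} (D : Copula n) :
    ∀ᵐ u ∂D.law, u ∈ Set.univ.pi fun _ => Set.Ioo (0 : ℝ) 1 := by
  simp only [Set.mem_univ_pi]
  refine ae_all_iff.2 fun i => ?_
  have h : ∀ᵐ x ∂(D.law.map fun u => u i), x ∈ Set.Ioo (0 : ℝ) 1 := by
    rw [D.uniform_margins, ← Measure.restrict_congr_set Ioo_ae_eq_Icc]
    exact ae_restrict_mem measurableSet_Ioo
  exact ae_of_ae_map (measurable_pi_apply i).aemeasurable h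

theorem Copula.ext_law {n : ℕ} {D D' : Copula n} (h : D.law = D'.law) : D = D' := by
  cases D; cases D'; congr

/-- A copula is determined by its distribution function on `(0,1)ⁿ`. -/
theorem Copula.ext_df {n : ℕ} {D D' : Copula n}
    (h : ∀ z, D.df (stdCDFPi z) = D'.df (stdCDFPi z)) : D = D' := by
  -- The faces of the cube are null for a copula, so nothing is lost by pulling its law back along
  -- `stdCDFPi`, whose range is the open cube.
  have hm : ∀ E : Copula n, (E.law.comap stdCDFPi).map stdCDFPi = E.law := fun E => by
    rw [measurableEmbedding_stdCDFPi.map_comap, range_stdCDFPi]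
    exact Measure.restrict_eq_self_of_ae_mem E.ae_mem_Ioo
  have hp : ∀ E : Copula n, IsProbabilityMeasure (E.law.comap stdCDFPi) := fun E => by
    have : IsProbabilityMeasure ((E.law.comap stdCDFPi).map stdCDFPi) := by
      rw [hm]; infer_instance
    exact Measure.isProbabilityMeasure_of_map stdCDFPi
  have hc : ∀ (E : Copula n) z, (E.law.comap stdCDFPi) (Set.Iic z) = E.law (Set.Iic (stdCDFPi z)) :=
    fun E z => by
      conv_rhs => rw [← hm E]
      rw [measurableEmbedding_stdCDFPi.map_apply, preimage_stdCDFPi_Iic]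
  have := hp D; have := hp D'
  refine Copula.ext_law ?_
  rw [← hm D, ← hm D']
  congr 1
  refine ext_of_Iic_pi fun z => ?_
  rw [hc, hc]
  exact (measureReal_eq_measureReal_iff).1 (h z)

/-- The copula of a law on `ℝⁿ` with standard normal margins. -/
noncomputable def Copula.ofStdNormalMargins {n : ℕ} (μ : Measure (Fin n → ℝ))
    [IsProbabilityMeasure μ] (h : ∀ i, μ.map (fun z => z i) = gaussianReal 0 1) : Copula n where
  law := μ.map stdCDFPi
  isProbabilityMeasure := Measure.isProbabilityMeasure_map measurable_stdCDFPi.aemeasurable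
  uniform_margins i := by
    rw [Measure.map_map (measurable_pi_apply i) measurable_stdCDFPi, ← map_stdCDF_gaussianReal,
      ← h i, Measure.map_map continuous_stdCDF.measurable (measurable_pi_apply i)]
    rfl

theorem Copula.df_stdCDFPi_of_law_eq {n : ℕ} {D : Copula n} {μ : Measure (Fin n → ℝ)}
    (h : D.law = μ.map stdCDFPi) (z : Fin n → ℝ) : D.df (stdCDFPi z) = μ.real (Set.Iic z) := by
  rw [Copula.df, h, measureReal_def, measurableEmbedding_stdCDFPi.map_apply,
    preimage_stdCDFPi_Iic, measureReal_def]

theorem gaussianReal_map_standardize (m : ℝ) {v : NNReal} (hv : v ≠ 0) :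
    (gaussianReal m v).map (fun x => (x - m) / √v) = gaussianReal 0 1 := by
  have h : (fun x : ℝ => (x - m) / √v) = (fun x => x / √v) ∘ fun x => x - m := rfl
  rw [h, ← Measure.map_map (by fun_prop) (by fun_prop), gaussianReal_map_sub_const,
    gaussianReal_map_div_const, sub_self, zero_div]
  congr 1
  have : (.mk (√v ^ 2) (sq_nonneg _) : NNReal) = v := by
    ext; simp
  rw [this, div_self hv]

theorem cdf_gaussianReal (m : ℝ) {v : NNReal} (hv : v ≠ 0) (x : ℝ) :
    cdf (gaussianReal m v) x = stdCDF ((x - m) / √v) := by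
  have hs : 0 < √(v : ℝ) := Real.sqrt_pos.2 (by positivity)
  rw [stdCDF, cdf_eq_real, cdf_eq_real, ← gaussianReal_map_standardize m hv, measureReal_def,
    measureReal_def, Measure.map_apply (by fun_prop) measurableSet_Iic]
  congr 2
  ext y
  simp [div_le_div_iff_of_pos_right hs]

/-- The coordinatewise standardization `z ↦ (z - m) / √v`. -/
noncomputable def standardize {ι : Type*} (m : ℝ) (v : NNReal) (y : ι → ℝ) (i : ι) : ℝ :=
  (y i - m) / √v

theorem measurable_standardize {ι : Type*} (m : ℝ) (v : NNReal) :
    Measurable (standardize m v : (ι → ℝ) → ι → ℝ) :=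
  measurable_pi_lambda _ fun i => by unfold standardize; fun_prop

theorem map_standardize_eval {n : ℕ} {m : ℝ} {v : NNReal} (hv : v ≠ 0) {ν : Measure (Fin n → ℝ)}
    (h : ∀ i, ν.map (fun y => y i) = gaussianReal m v) (i : Fin n) :
    (ν.map (standardize m v)).map (fun z => z i) = gaussianReal 0 1 := by
  rw [Measure.map_map (measurable_pi_apply i) (measurable_standardize m v),
    ← gaussianReal_map_standardize m hv, ← h i, Measure.map_map (by fun_prop) (by fun_prop)]
  rfl

/-- A copula of a law with identical nondegenerate Gaussian margins is the law of the coordinates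
transformed by their distribution functions. -/
theorem Copula.isCopulaOf_iff {n : ℕ} {m : ℝ} {v : NNReal} (hv : v ≠ 0)
    {ν : Measure (Fin n → ℝ)} [IsProbabilityMeasure ν]
    (h : ∀ i, ν.map (fun y => y i) = gaussianReal m v) (D : Copula n) :
    D.IsCopulaOf ν ↔ D.law = (ν.map (standardize m v)).map stdCDFPi := by
  have hs : 0 < √(v : ℝ) := Real.sqrt_pos.2 (by positivity)
  have := Measure.isProbabilityMeasure_map (μ := ν)
    (measurable_standardize (ι := Fin n) m v).aemeasurable
  have hcdf : ∀ x : Fin n → ℝ,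
      (fun i => cdf (ν.map (fun y => y i)) (x i)) = stdCDFPi (standardize m v x) := fun x => by
    funext i; rw [h, cdf_gaussianReal m hv]; rfl
  have key : ∀ x, (ν.map (standardize m v)).real (Set.Iic (standardize m v x)) =
      ν.real (Set.Iic x) := fun x => by
    rw [measureReal_def, Measure.map_apply (measurable_standardize m v) measurableSet_Iic,
      measureReal_def]
    congr 2
    ext y
    simp [Pi.le_def, standardize, div_le_div_iff_of_pos_right hs]
  simp only [Copula.IsCopulaOf, hcdf]
  constructor
  · intro hD
    let E := Copula.ofStdNormalMargins _ (map_standardize_eval hv h)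
    have : D = E := Copula.ext_df fun z => by
      have hz : z = standardize m v (fun i => √v * z i + m) := by
        funext i; simp [standardize, hs.ne']
      rw [Copula.df_stdCDFPi_of_law_eq (D := E) rfl, hz, key, hD]
    rw [this]; rfl
  · intro hD x
    rw [Copula.df_stdCDFPi_of_law_eq hD, key]

/-! ### The bivariate normal distribution function. -/

/-- The residual `(Y - a X) / √(1 - a²)` is standard normal and uncorrelated with `X`, hence
independent of it. The integral is Fubini's theorem for this product law, sliced at `X = t`. -/
theorem measureReal_le_and_le_of_hasGaussianLaw {Ω : Type*} [MeasurableSpace Ω] {Q : Measure Ω}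
    [IsProbabilityMeasure Q] {X Y : Ω → ℝ} {a : ℝ} (ha : a ∈ Set.Ioo (-1 : ℝ) 1)
    (hmX : Measurable X) (hmY : Measurable Y)
    (hXY : HasGaussianLaw (fun ω => (X ω, Y ω)) Q) (hX : Q.map X = gaussianReal 0 1)
    (hY : Q.map Y = gaussianReal 0 1) (hcov : cov[X, Y; Q] = a) (x y : ℝ) :
    Q.real {ω | X ω ≤ x ∧ Y ω ≤ y} =
      ∫ t in Set.Iic x, stdPDF t * stdCDF ((y - a * t) / √(1 - a ^ 2)) := by
  have hs2 : 0 < 1 - a ^ 2 := by nlinarith [ha.1, ha.2]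
  have hs : 0 < √(1 - a ^ 2) := Real.sqrt_pos.2 hs2
  set s := √(1 - a ^ 2) with hsdef
  have hss : s ^ 2 = 1 - a ^ 2 := Real.sq_sqrt hs2.le
  have hX2 : MemLp X 2 Q := hXY.fst.memLp_two
  have hY2 : MemLp Y 2 Q := hXY.snd.memLp_two
  have hmean : ∀ Z : Ω → ℝ, Measurable Z → Q.map Z = gaussianReal 0 1 → ∫ ω, Z ω ∂Q = 0 := by
    intro Z hZ h
    have := integral_id_gaussianReal (μ := 0) (v := 1)
    rwa [← h, integral_map hZ.aemeasurable (by fun_prop)] at this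
  have hvar : ∀ Z : Ω → ℝ, Measurable Z → Q.map Z = gaussianReal 0 1 → Var[Z; Q] = 1 := by
    intro Z hZ h
    have := variance_id_gaussianReal (μ := 0) (v := 1)
    rwa [← h, variance_map (by fun_prop) hZ.aemeasurable] at this
  let W : Ω → ℝ := fun ω => (Y ω - a * X ω) / s
  have hmW : Measurable W := by fun_prop
  have hXW : HasGaussianLaw (fun ω => (X ω, W ω)) Q := by
    let L : ℝ × ℝ →L[ℝ] ℝ × ℝ := (ContinuousLinearMap.fst ℝ ℝ ℝ).prod
      (s⁻¹ • (ContinuousLinearMap.snd ℝ ℝ ℝ - a • ContinuousLinearMap.fst ℝ ℝ ℝ))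
    have := hXY.map_fun L
    refine this.congr (Filter.Eventually.of_forall fun ω => ?_)
    simp [L, W, div_eq_inv_mul]
  have hW : W = s⁻¹ • (Y - a • X) := by
    funext ω; simp [W, div_eq_inv_mul]
  have hcXW : cov[X, W; Q] = 0 := by
    rw [hW, covariance_smul_right, covariance_sub_right hX2 hY2 (hX2.const_smul a),
      covariance_smul_right, hcov, covariance_self hmX.aemeasurable, hvar X hmX hX]
    simp
  have hvW : Var[W; Q] = 1 := by
    rw [hW, variance_smul, variance_sub hY2 (hX2.const_smul a), variance_smul,
      covariance_smul_right, covariance_comm, hcov, hvar X hmX hX, hvar Y hmY hY]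
    field_simp
    rw [hss]; ring
  have hmeW : ∫ ω, W ω ∂Q = 0 := by
    have h1 : Integrable X Q := hX2.integrable (by norm_num)
    have h2 : Integrable Y Q := hY2.integrable (by norm_num)
    simp only [W]
    rw [integral_div, integral_sub h2 (h1.const_mul a), integral_const_mul, hmean X hmX hX,
      hmean Y hmY hY]
    simp
  have hlW : Q.map W = gaussianReal 0 1 := by
    rw [hXW.snd.map_eq_gaussianReal, hmeW, hvW]; simp
  have hind := hXW.indepFun_of_covariance_eq_zero hcXW
  have hprod := (indepFun_iff_map_prod_eq_prod_map_map hmX.aemeasurable hmW.aemeasurable).1 hind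
  rw [hX, hlW] at hprod
  let T : Set (ℝ × ℝ) := {p | p.1 ≤ x ∧ p.2 ≤ (y - a * p.1) / s}
  have hT : MeasurableSet T :=
    (measurableSet_le measurable_fst measurable_const).inter
      (measurableSet_le measurable_snd (by fun_prop : Measurable fun p : ℝ × ℝ => (y - a * p.1) / s))
  have hpre : {ω | X ω ≤ x ∧ Y ω ≤ y} = (fun ω => (X ω, W ω)) ⁻¹' T := by
    ext ω
    simp [T, W, div_le_div_iff_of_pos_right hs]
  have hslice : ∀ t, gaussianReal 0 1 (Prod.mk t ⁻¹' T) =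
      (Set.Iic x).indicator (fun t => ENNReal.ofReal (stdCDF ((y - a * t) / s))) t := by
    intro t
    by_cases ht : t ≤ x
    · rw [Set.indicator_of_mem (by exact ht), stdCDF, ofReal_cdf]
      congr 1; ext w; simp [T, ht]
    · rw [Set.indicator_of_notMem (by exact ht)]
      convert! measure_empty (μ := gaussianReal 0 1)
      ext w; simp [T, ht]
  rw [hpre, measureReal_def, ← Measure.map_apply (by fun_prop) hT, hprod, Measure.prod_apply hT,
    lintegral_congr hslice, lintegral_indicator measurableSet_Iic,
    ← integral_toReal]
  · simp only [ENNReal.toReal_ofReal (stdCDF_mem_Ioo _).1.le]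
    rw [← integral_indicator measurableSet_Iic, integral_gaussianReal_eq_integral_smul one_ne_zero,
      ← integral_indicator measurableSet_Iic]
    congr 1; funext t
    by_cases ht : t ∈ Set.Iic x <;> simp [ht, stdPDF]
  · have := continuous_stdCDF.measurable
    fun_prop
  · exact Filter.Eventually.of_forall fun t => ENNReal.ofReal_lt_top

/-- The distribution function of the bivariate standard normal law with correlation `a`. -/
noncomputable def bivariateCDF (a x y : ℝ) : ℝ :=
  ∫ t in Set.Iic x, stdPDF t * stdCDF ((y - a * t) / √(1 - a ^ 2))

theorem hasDerivAt_bivariateCDF_left (a x y : ℝ) :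
    HasDerivAt (fun x => bivariateCDF a x y)
      (stdPDF x * stdCDF ((y - a * x) / √(1 - a ^ 2))) x := by
  have hc : Continuous fun t => stdPDF t * stdCDF ((y - a * t) / √(1 - a ^ 2)) := by
    have := continuous_stdCDF
    have := continuous_stdPDF
    fun_prop
  refine hasDerivAt_setIntegral_Iic (integrable_stdPDF.mono hc.aestronglyMeasurable
    (Filter.Eventually.of_forall fun t => ?_)) hc x
  have := stdCDF_mem_Ioo ((y - a * t) / √(1 - a ^ 2))
  rw [norm_mul, Real.norm_of_nonneg this.1.le]
  exact mul_le_of_le_one_right (norm_nonneg _) this.2.le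

section BivariateNormal

variable {a : ℝ}

theorem posSemidef_correlation (ha : a ∈ Set.Ioo (-1 : ℝ) 1) :
    (!![1, a; a, 1] : Matrix (Fin 2) (Fin 2) ℝ).PosSemidef := by
  refine Matrix.PosSemidef.of_dotProduct_mulVec_nonneg ?_ fun x => ?_
  · ext i j; fin_cases i <;> fin_cases j <;> simp
  · simp [Matrix.mulVec, dotProduct, Fin.sum_univ_two]
    nlinarith [sq_nonneg (x 0 + a * x 1), sq_nonneg (x 1), ha.1, ha.2,
      mul_nonneg (by nlinarith [ha.1, ha.2] : 0 ≤ 1 - a ^ 2) (sq_nonneg (x 1))]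

/-- The bivariate standard normal law with correlation `a`. -/
noncomputable def bivariateNormal (a : ℝ) : Measure (Fin 2 → ℝ) :=
  (multivariateGaussian 0 !![1, a; a, 1]).map
      (fun z : EuclideanSpace ℝ (Fin 2) => fun i => z i)

instance : IsProbabilityMeasure (bivariateNormal a) :=
  Measure.isProbabilityMeasure_map (by fun_prop)

theorem map_eval_bivariateNormal (ha : a ∈ Set.Ioo (-1 : ℝ) 1) (i : Fin 2) :
    (bivariateNormal a).map (fun z => z i) = gaussianReal 0 1 := by
  rw [bivariateNormal, Measure.map_map (by fun_prop) (by fun_prop)]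
  have := (measurePreserving_eval_multivariateGaussian (μ := 0) (i := i)
    (posSemidef_correlation ha)).map_eq
  refine Eq.trans this ?_
  fin_cases i <;> simp

/-- The symmetry comes from conditioning on the other coordinate. It makes the derivative in `y`
another instance of the fundamental theorem of calculus, so nothing is differentiated under the
integral sign. -/
theorem bivariateNormal_Iic (ha : a ∈ Set.Ioo (-1 : ℝ) 1) (x y : ℝ) :
    (bivariateNormal a).real (Set.Iic ![x, y]) = bivariateCDF a x y ∧
      bivariateCDF a x y = bivariateCDF a y x := by
  have hS := posSemidef_correlation ha
  have hG : ∀ i j : Fin 2, HasGaussianLaw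
      (fun z : EuclideanSpace ℝ (Fin 2) => (z i, z j)) (multivariateGaussian 0 !![1, a; a, 1]) :=
    fun i j => by
      have := (IsGaussian.hasGaussianLaw_id (μ := multivariateGaussian 0 !![1, a; a, 1])).map_fun
        ((EuclideanSpace.proj (𝕜 := ℝ) i).prod (EuclideanSpace.proj j))
      exact this
  have hm : ∀ i : Fin 2, (multivariateGaussian 0 !![1, a; a, 1]).map
      (fun z : EuclideanSpace ℝ (Fin 2) => z i) = gaussianReal 0 1 := fun i => by
    rw [← map_eval_bivariateNormal ha i, bivariateNormal, Measure.map_map (by fun_prop)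
      (by fun_prop)]
    rfl
  have hf : ∀ i : Fin 2, Measurable fun z : EuclideanSpace ℝ (Fin 2) => z i := fun i => by
    fun_prop
  have h01 := measureReal_le_and_le_of_hasGaussianLaw ha (hf 0) (hf 1) (hG 0 1)
    (hm 0) (hm 1) (by rw [covariance_eval_multivariateGaussian hS]; simp) x y
  have h10 := measureReal_le_and_le_of_hasGaussianLaw ha (hf 1) (hf 0) (hG 1 0)
    (hm 1) (hm 0) (by rw [covariance_eval_multivariateGaussian hS]; simp) y x
  refine ⟨?_, ?_⟩
  · rw [bivariateCDF, ← h01, measureReal_def, bivariateNormal, Measure.map_apply (by fun_prop)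
      measurableSet_Iic, measureReal_def]
    congr 2
    ext z
    simp [Pi.le_def, Fin.forall_fin_two]
  · rw [bivariateCDF, ← h01, bivariateCDF, ← h10]
    simp only [and_comm]

theorem hasStrictFDerivAt_bivariateCDF (ha : a ∈ Set.Ioo (-1 : ℝ) 1) (p : ℝ × ℝ) :
    HasStrictFDerivAt (fun p : ℝ × ℝ => bivariateCDF a p.1 p.2)
      ((ContinuousLinearMap.toSpanSingleton ℝ
          (stdPDF p.1 * stdCDF ((p.2 - a * p.1) / √(1 - a ^ 2)))).coprod
        (ContinuousLinearMap.toSpanSingleton ℝ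
          (stdPDF p.2 * stdCDF ((p.1 - a * p.2) / √(1 - a ^ 2))))) p := by
  have hΦ := continuous_stdCDF
  have hφ := continuous_stdPDF
  refine hasStrictFDerivAt_uncurry_coprod (f := fun x y => bivariateCDF a x y)
    (f₁ := fun x y => ContinuousLinearMap.toSpanSingleton ℝ
      (stdPDF x * stdCDF ((y - a * x) / √(1 - a ^ 2))))
    (f₂ := fun x y => ContinuousLinearMap.toSpanSingleton ℝ
      (stdPDF y * stdCDF ((x - a * y) / √(1 - a ^ 2))))
    (Filter.Eventually.of_forall fun q => (hasDerivAt_bivariateCDF_left a q.1 q.2).hasFDerivAt)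
    (Filter.Eventually.of_forall fun q => ?_) ?_ ?_
  · simp only [fun y => (bivariateNormal_Iic ha q.1 y).2]
    exact (hasDerivAt_bivariateCDF_left a q.2 q.1).hasFDerivAt
  · refine Continuous.continuousAt ?_
    refine (ContinuousLinearMap.toSpanSingletonCLE (𝕜 := ℝ) (E := ℝ)).continuous.comp
      (?_ : Continuous fun q : ℝ × ℝ => stdPDF q.1 * stdCDF ((q.2 - a * q.1) / √(1 - a ^ 2)))
    fun_prop
  · refine Continuous.continuousAt ?_
    refine (ContinuousLinearMap.toSpanSingletonCLE (𝕜 := ℝ) (E := ℝ)).continuous.comp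
      (?_ : Continuous fun q : ℝ × ℝ => stdPDF q.2 * stdCDF ((q.1 - a * q.2) / √(1 - a ^ 2)))
    fun_prop

/-- Both partial derivatives are explicit smooth expressions in `φ` and `Φ`, so the total derivative
is smooth. -/
theorem contDiff_bivariateCDF (ha : a ∈ Set.Ioo (-1 : ℝ) 1) :
    ContDiff ℝ (⊤ : ℕ∞) (fun p : ℝ × ℝ => bivariateCDF a p.1 p.2) := by
  rw [contDiff_infty_iff_fderiv]
  refine ⟨fun p => (hasStrictFDerivAt_bivariateCDF ha p).hasFDerivAt.differentiableAt, ?_⟩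
  rw [funext fun p => (hasStrictFDerivAt_bivariateCDF ha p).hasFDerivAt.fderiv]
  have hΦ := contDiff_stdCDF
  have hφ := contDiff_stdPDF (n := (⊤ : ℕ∞))
  have h1 : ContDiff ℝ (⊤ : ℕ∞)
      fun q : ℝ × ℝ => stdPDF q.1 * stdCDF ((q.2 - a * q.1) / √(1 - a ^ 2)) := by fun_prop
  have h2 : ContDiff ℝ (⊤ : ℕ∞)
      fun q : ℝ × ℝ => stdPDF q.2 * stdCDF ((q.1 - a * q.2) / √(1 - a ^ 2)) := by fun_prop
  convert! (h1.smul (contDiff_const (c := ContinuousLinearMap.fst ℝ ℝ ℝ))).add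
    (h2.smul (contDiff_const (c := ContinuousLinearMap.snd ℝ ℝ ℝ))) using 2
  ext <;> simp

end BivariateNormal

/-! ### Gaussian pair copulas and their derivatives. -/

/-- The quantile function of the standard normal law. -/
noncomputable def stdQuantile : ℝ → ℝ := Function.invFun stdCDF

theorem stdQuantile_stdCDF (x : ℝ) : stdQuantile (stdCDF x) = x :=
  Function.leftInverse_invFun strictMono_stdCDF.injective x

theorem stdCDF_stdQuantile {u : ℝ} (hu : u ∈ Set.Ioo (0 : ℝ) 1) : stdCDF (stdQuantile u) = u :=
  Function.invFun_eq (range_stdCDF.symm ▸ hu : u ∈ Set.range stdCDF)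

theorem hasDerivAt_stdQuantile (x : ℝ) : HasDerivAt stdQuantile (stdPDF x)⁻¹ (stdCDF x) := by
  have h : HasStrictDerivAt stdCDF (stdPDF x) x :=
    contDiff_stdCDF.contDiffAt.hasStrictDerivAt' (hasDerivAt_stdCDF x) (by simp)
  exact (h.to_local_left_inverse (stdPDF_pos x).ne'
    (Filter.Eventually.of_forall stdQuantile_stdCDF)).hasDerivAt

/-- Bootstrapping: the derivative is `1 / φ` composed with the quantile function itself, so each
order of smoothness yields the next. -/
theorem contDiffOn_stdQuantile : ContDiffOn ℝ (⊤ : ℕ∞) stdQuantile (Set.Ioo 0 1) := by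
  have hd : ∀ u ∈ Set.Ioo (0 : ℝ) 1, HasDerivAt stdQuantile (stdPDF (stdQuantile u))⁻¹ u :=
    fun u hu => by
      have := hasDerivAt_stdQuantile (stdQuantile u)
      rwa [stdCDF_stdQuantile hu] at this
  rw [contDiffOn_infty]
  intro n
  induction n with
  | zero =>
    exact contDiffOn_zero.2 fun u hu => (hd u hu).continuousAt.continuousWithinAt
  | succ n ih =>
    push_cast
    rw [contDiffOn_succ_iff_deriv_of_isOpen isOpen_Ioo]
    refine ⟨fun u hu => (hd u hu).differentiableAt.differentiableWithinAt, by simp, ?_⟩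
    refine ContDiffOn.congr ?_ fun u hu => (hd u hu).deriv
    exact (contDiff_stdPDF.comp_contDiffOn ih).inv fun u _ => (stdPDF_pos _).ne'

section GaussianPairCopula

variable {C : Copula 2} {a : ℝ}

theorem eventually_mem_Ioo_stdCDF (x : ℝ) : ∀ᶠ u in nhds (stdCDF x), u ∈ Set.Ioo (0 : ℝ) 1 :=
  isOpen_Ioo.mem_nhds (stdCDF_mem_Ioo x)

theorem df_of_law_eq (ha : a ∈ Set.Ioo (-1 : ℝ) 1)
    (hC : C.law = (bivariateNormal a).map stdCDFPi) (x y : ℝ) :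
    C.df ![stdCDF x, stdCDF y] = bivariateCDF a x y := by
  rw [← (bivariateNormal_Iic ha x y).1, ← Copula.df_stdCDFPi_of_law_eq hC]
  congr 1
  funext i; fin_cases i <;> rfl

/-- By the chain rule, the factor `φ(x)` from the bivariate distribution function cancels the
derivative `1 / φ(x)` of the quantile function. -/
theorem h₁_of_law_eq (ha : a ∈ Set.Ioo (-1 : ℝ) 1)
    (hC : C.law = (bivariateNormal a).map stdCDFPi) (x y : ℝ) :
    C.h₁ (stdCDF x) (stdCDF y) = stdCDF ((y - a * x) / √(1 - a ^ 2)) := by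
  have h := hasDerivAt_bivariateCDF_left a x y
  rw [← stdQuantile_stdCDF x] at h
  have h := h.comp (stdCDF x) (hasDerivAt_stdQuantile x)
  have he : (fun s => C.df ![s, stdCDF y]) =ᶠ[nhds (stdCDF x)]
      (fun x => bivariateCDF a x y) ∘ stdQuantile := by
    filter_upwards [eventually_mem_Ioo_stdCDF x] with u hu
    rw [Function.comp_apply, ← df_of_law_eq ha hC, stdCDF_stdQuantile hu]
  rw [Copula.h₁, he.deriv_eq, h.deriv, stdQuantile_stdCDF]
  field_simp [(stdPDF_pos x).ne']

theorem h₂_of_law_eq (ha : a ∈ Set.Ioo (-1 : ℝ) 1)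
    (hC : C.law = (bivariateNormal a).map stdCDFPi) (x y : ℝ) :
    C.h₂ (stdCDF x) (stdCDF y) = stdCDF ((x - a * y) / √(1 - a ^ 2)) := by
  have h := hasDerivAt_bivariateCDF_left a y x
  rw [← stdQuantile_stdCDF y] at h
  have h := h.comp (stdCDF y) (hasDerivAt_stdQuantile y)
  have he : (fun s => C.df ![stdCDF x, s]) =ᶠ[nhds (stdCDF y)]
      (fun y => bivariateCDF a y x) ∘ stdQuantile := by
    filter_upwards [eventually_mem_Ioo_stdCDF y] with u hu
    rw [Function.comp_apply, ← (bivariateNormal_Iic ha _ _).2, ← df_of_law_eq ha hC,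
      stdCDF_stdQuantile hu]
  rw [Copula.h₂, he.deriv_eq, h.deriv, stdQuantile_stdCDF]
  field_simp [(stdPDF_pos y).ne']

theorem density_of_law_eq (ha : a ∈ Set.Ioo (-1 : ℝ) 1)
    (hC : C.law = (bivariateNormal a).map stdCDFPi) (x y : ℝ) :
    C.density (stdCDF x) (stdCDF y) =
      stdPDF ((x - a * y) / √(1 - a ^ 2)) / (√(1 - a ^ 2) * stdPDF x) := by
  have h1 : HasDerivAt (fun x => stdCDF ((x - a * y) / √(1 - a ^ 2)))
      (stdPDF ((x - a * y) / √(1 - a ^ 2)) * (1 / √(1 - a ^ 2))) x :=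
    (hasDerivAt_stdCDF _).comp x (((hasDerivAt_id x).sub_const _).div_const _)
  rw [← stdQuantile_stdCDF x] at h1
  have h := h1.comp (stdCDF x) (hasDerivAt_stdQuantile x)
  have he : (fun s => C.h₂ s (stdCDF y)) =ᶠ[nhds (stdCDF x)]
      (fun x => stdCDF ((x - a * y) / √(1 - a ^ 2))) ∘ stdQuantile := by
    filter_upwards [eventually_mem_Ioo_stdCDF x] with u hu
    rw [Function.comp_apply, ← h₂_of_law_eq ha hC, stdCDF_stdQuantile hu]
  rw [Copula.density, he.deriv_eq, h.deriv, stdQuantile_stdCDF, mul_one_div, ← div_eq_mul_inv,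
    div_div]

theorem sqrt_one_sub_sq_pos (ha : a ∈ Set.Ioo (-1 : ℝ) 1) : 0 < √(1 - a ^ 2) :=
  Real.sqrt_pos.2 (by nlinarith [ha.1, ha.2])

/-- Both forms have the same Gaussian exponent. In this one the denominator involves the second
argument, the old forward error, which is what makes the vine product telescope. -/
theorem density_of_law_eq' (ha : a ∈ Set.Ioo (-1 : ℝ) 1)
    (hC : C.law = (bivariateNormal a).map stdCDFPi) (x y : ℝ) :
    C.density (stdCDF x) (stdCDF y) =
      stdPDF ((y - a * x) / √(1 - a ^ 2)) / (√(1 - a ^ 2) * stdPDF y) := by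
  have hs := sqrt_one_sub_sq_pos ha
  have hss : √(1 - a ^ 2) ^ 2 = 1 - a ^ 2 := Real.sq_sqrt (by nlinarith [ha.1, ha.2])
  rw [density_of_law_eq ha hC, div_eq_div_iff (mul_pos hs (stdPDF_pos x)).ne'
    (mul_pos hs (stdPDF_pos y)).ne', mul_left_comm, mul_left_comm (stdPDF _) (√_)]
  congr 1
  simp only [stdPDF_eq]
  rw [mul_mul_mul_comm, mul_mul_mul_comm _ (Real.exp _) _ (Real.exp (-x ^ 2 / 2)),
    ← Real.exp_add, ← Real.exp_add]
  congr 2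
  field_simp
  rw [hss]
  ring

theorem isSmoothPositive_of_law_eq (ha : a ∈ Set.Ioo (-1 : ℝ) 1)
    (hC : C.law = (bivariateNormal a).map stdCDFPi) : C.IsSmoothPositive where
  contDiffOn := by
    refine ContDiffOn.congr (f := fun p : ℝ × ℝ =>
      bivariateCDF a (stdQuantile p.1) (stdQuantile p.2)) ?_ fun p hp => ?_
    · exact (contDiff_bivariateCDF ha).comp_contDiffOn
        (ContDiffOn.prodMk (contDiffOn_stdQuantile.comp contDiffOn_fst fun p hp => hp.1)
          (contDiffOn_stdQuantile.comp contDiffOn_snd fun p hp => hp.2))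
    · rw [← df_of_law_eq ha hC, stdCDF_stdQuantile hp.1, stdCDF_stdQuantile hp.2]
  density_pos u hu v hv := by
    rw [← stdCDF_stdQuantile hu, ← stdCDF_stdQuantile hv, density_of_law_eq ha hC]
    exact div_pos (stdPDF_pos _) (mul_pos (sqrt_one_sub_sq_pos ha) (stdPDF_pos _))

/-- The Gaussian pair copula with correlation `a`. -/
noncomputable def gaussianCopula (ha : a ∈ Set.Ioo (-1 : ℝ) 1) : Copula 2 :=
  Copula.ofStdNormalMargins (bivariateNormal a) (map_eval_bivariateNormal ha)

theorem Copula.IsGaussian.exists_law_eq (hC : C.IsGaussian) :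
    ∃ a ∈ Set.Ioo (-1 : ℝ) 1, C.law = (bivariateNormal a).map stdCDFPi := by
  obtain ⟨a, ha, h⟩ := hC
  refine ⟨a, ha, ?_⟩
  rw [(Copula.isCopulaOf_iff one_ne_zero (map_eval_bivariateNormal ha) C).1 h]
  congr 1
  convert! Measure.map_id
  ext; simp [standardize]

end GaussianPairCopula

/-! ### The lattice recursion of linear prediction. -/

section LatticeFilter

variable {E E' : Type*} [AddCommGroup E] [Module ℝ E] [AddCommGroup E'] [Module ℝ E']

/-- The normalized forward and backward prediction errors of order `k` of a sequence `z`, computed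
by the lattice recursion with partial correlations `a 0, a 1, …`. The forward error at time `t` is
that of predicting `z t` from `z (t - k), …, z (t - 1)`, the backward error that of predicting
`z t` from `z (t + 1), …, z (t + k)`. -/
noncomputable def latticeFilter (a : ℕ → ℝ) (z : ℤ → E) : ℕ → ℤ → E × E
  | 0, t => (z t, z t)
  | k + 1, t =>
    ((√(1 - a k ^ 2))⁻¹ •
        ((latticeFilter a z k t).1 - a k • (latticeFilter a z k (t - k - 1)).2),
      (√(1 - a k ^ 2))⁻¹ •
        ((latticeFilter a z k t).2 - a k • (latticeFilter a z k (t + k + 1)).1))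

theorem map_latticeFilter (L : E →ₗ[ℝ] E') (a : ℕ → ℝ) (z : ℤ → E) (k : ℕ) (t : ℤ) :
    latticeFilter a (fun s => L (z s)) k t =
      (L (latticeFilter a z k t).1, L (latticeFilter a z k t).2) := by
  induction k generalizing t with
  | zero => rfl
  | succ k ih => simp only [latticeFilter, ih, map_smul, map_sub]

/-- The errors of order `k` look only `k` steps into the past (forward) or future (backward), so a
finite window and its extension by zero give the same errors of full order. -/
theorem latticeFilter_congr (a : ℕ → ℝ) {z z' : ℤ → E} (k : ℕ) (t : ℤ) :
    ((∀ s, t - k ≤ s → s ≤ t → z s = z' s) →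
      (latticeFilter a z k t).1 = (latticeFilter a z' k t).1) ∧
    ((∀ s, t ≤ s → s ≤ t + k → z s = z' s) →
      (latticeFilter a z k t).2 = (latticeFilter a z' k t).2) := by
  induction k generalizing t with
  | zero =>
    exact ⟨fun h => h t (by simp) le_rfl, fun h => h t le_rfl (by simp)⟩
  | succ k ih =>
    push_cast
    refine ⟨fun h => ?_, fun h => ?_⟩
    · simp only [latticeFilter]
      rw [(ih t).1 fun s h1 h2 => h s (by omega) (by omega),
        (ih (t - k - 1)).2 fun s h1 h2 => h s (by omega) (by omega)]
    · simp only [latticeFilter]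
      rw [(ih t).2 fun s h1 h2 => h s (by omega) (by omega),
        (ih (t + k + 1)).1 fun s h1 h2 => h s (by omega) (by omega)]

theorem latticeFilter_zero (a : ℕ → ℝ) (k : ℕ) (t : ℤ) :
    latticeFilter a (fun _ => (0 : E)) k t = 0 := by
  simpa using! map_latticeFilter (0 : E →ₗ[ℝ] E) a (fun _ => (0 : E)) k t

/-- The product of the normalizing factors of the lattice recursion up to order `k`. -/
noncomputable def latticeScale (a : ℕ → ℝ) (k : ℕ) : ℝ :=
  ∏ l ∈ Finset.range k, √(1 - a l ^ 2)

theorem latticeScale_pos {a : ℕ → ℝ} (ha : ∀ k, a k ∈ Set.Ioo (-1 : ℝ) 1) (k : ℕ) :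
    0 < latticeScale a k :=
  Finset.prod_pos fun l _ => sqrt_one_sub_sq_pos (ha l)

/-- This isolates the coefficient of `z t` in the forward error; it is a diagonal entry of the
innovation matrix. -/
theorem latticeFilter_fst_eq_smul (a : ℕ → ℝ) {z : ℤ → E} (k : ℕ) (t : ℤ)
    (h : ∀ s, t - k ≤ s → s < t → z s = 0) :
    (latticeFilter a z k t).1 = (latticeScale a k)⁻¹ • z t := by
  induction k with
  | zero => simp [latticeFilter, latticeScale]
  | succ k ih =>
    push_cast at h
    have h0 : (latticeFilter a z k (t - k - 1)).2 = 0 := by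
      rw [(latticeFilter_congr a (z' := fun _ => 0) k (t - k - 1)).2
        fun s h1 h2 => h s (by omega) (by omega), latticeFilter_zero]; rfl
    simp only [latticeFilter]
    rw [h0, ih fun s h1 h2 => h s (by omega) h2, smul_zero, sub_zero, smul_smul, latticeScale,
      latticeScale, Finset.prod_range_succ, mul_inv, mul_comm]

end LatticeFilter

/-! ### The s-vine density in normal scores. -/

section Density

variable {C : ℕ → Copula 2} {a : ℕ → ℝ}

/-- The Gaussian `h`-functions conjugated by `Φ` are exactly one lattice step. Dropping the first
argument shifts the window by one, dropping the last leaves its start fixed. -/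
theorem rosenblatt_stdCDF (ha : ∀ k, a k ∈ Set.Ioo (-1 : ℝ) 1)
    (hC : ∀ k, (C (k + 1)).law = (bivariateNormal (a k)).map stdCDFPi) (z : ℤ → ℝ) (k : ℕ) (t : ℤ) :
    forwardRosenblatt C k (fun m => stdCDF (z (t + 1 + (m : ℕ)))) (stdCDF (z (t + k + 1))) =
        stdCDF (latticeFilter a z k (t + k + 1)).1 ∧
      backwardRosenblatt C k (fun m => stdCDF (z (t + 1 + (m : ℕ)))) (stdCDF (z t)) =
        stdCDF (latticeFilter a z k t).2 := by
  induction k generalizing t with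
  | zero => exact ⟨rfl, rfl⟩
  | succ k ih =>
    have ht : Fin.tail (fun m : Fin (k + 1) => stdCDF (z (t + 1 + (m : ℕ)))) =
        fun m : Fin k => stdCDF (z (t + 1 + 1 + (m : ℕ))) := by
      funext m; simp only [Fin.tail, Fin.val_succ]; congr 2; push_cast; ring
    have hi : Fin.init (fun m : Fin (k + 1) => stdCDF (z (t + 1 + (m : ℕ)))) =
        fun m : Fin k => stdCDF (z (t + 1 + (m : ℕ))) := rfl
    simp only [forwardRosenblatt, backwardRosenblatt] at ih ⊢
    simp only [rosenblatt, ht, hi, latticeFilter]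
    constructor
    · have e1 : t + 1 + ((0 : Fin (k + 1)) : ℕ) = t + 1 := by simp
      have e2 : t + ((k + 1 : ℕ) : ℤ) + 1 = t + 1 + k + 1 := by push_cast; ring
      have e3 : t + 1 + (k : ℤ) + 1 - k - 1 = t + 1 := by ring
      rw [e1, e2, e3, (ih (t + 1)).1, (ih (t + 1)).2, h₁_of_law_eq (ha k) (hC k), smul_eq_mul,
        smul_eq_mul, ← div_eq_inv_mul]
    · have e1 : t + 1 + ((Fin.last k : Fin (k + 1)) : ℕ) = t + k + 1 := by
        rw [Fin.val_last]; ring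
      rw [e1, (ih t).1, (ih t).2, h₂_of_law_eq (ha k) (hC k), smul_eq_mul,
        smul_eq_mul, ← div_eq_inv_mul]

/-- The extension by zero of a finite sequence to the integers. -/
noncomputable def extendByZero {n : ℕ} (z : Fin n → ℝ) (t : ℤ) : ℝ :=
  if h : 0 ≤ t ∧ t < n then z ⟨t.toNat, by omega⟩ else 0

theorem extendByZero_natCast {n : ℕ} (z : Fin n → ℝ) {i : ℕ} (hi : i < n) :
    extendByZero z i = z ⟨i, hi⟩ := by
  simp [extendByZero, hi]

/-- Each factor is the ratio of `φ` at consecutive forward errors at time `t`, divided by one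
normalizing factor; the ratios telescope over the order. -/
theorem prod_density_eq_div (ha : ∀ k, a k ∈ Set.Ioo (-1 : ℝ) 1)
    (hC : ∀ k, (C (k + 1)).law = (bivariateNormal (a k)).map stdCDFPi) (z : ℤ → ℝ) (n : ℕ) (t : ℤ) :
    ∏ k ∈ Finset.range n, (C (k + 1)).density (stdCDF (latticeFilter a z k (t - k - 1)).2)
        (stdCDF (latticeFilter a z k t).1) =
      stdPDF (latticeFilter a z n t).1 / (stdPDF (z t) * latticeScale a n) := by
  induction n with
  | zero => simp [latticeFilter, latticeScale, (stdPDF_pos (z t)).ne']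
  | succ n ih =>
    have h1 := (stdPDF_pos (latticeFilter a z n t).1).ne'
    rw [Finset.prod_range_succ, ih, density_of_law_eq' (ha n) (hC n), latticeScale, latticeScale,
      Finset.prod_range_succ]
    simp only [latticeFilter, smul_eq_mul, ← div_eq_inv_mul]
    rw [div_mul_div_comm, mul_comm (stdPDF (latticeFilter a z n t).1), ← mul_assoc,
      mul_div_mul_right _ _ h1, mul_assoc]

theorem sVineDensity_stdCDFPi (ha : ∀ k, a k ∈ Set.Ioo (-1 : ℝ) 1)
    (hC : ∀ k, (C (k + 1)).law = (bivariateNormal (a k)).map stdCDFPi) {n : ℕ} (z : Fin n → ℝ) :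
    sVineDensity C n (stdCDFPi z) =
      ∏ j : Fin n, stdPDF (latticeFilter a (extendByZero z) j j).1 /
        (stdPDF (z j) * latticeScale a j) := by
  rcases n with _ | N
  · simp [sVineDensity]
  set w := extendByZero z with hw
  have hz : ∀ i (hi : i < N + 1), stdCDFPi z ⟨i, hi⟩ = stdCDF (w i) := fun i hi => by
    rw [stdCDFPi, hw, extendByZero_natCast z hi]
  let f : ℕ → ℕ → ℝ := fun k i => (C (k + 1)).density (stdCDF (latticeFilter a w k i).2)
    (stdCDF (latticeFilter a w k (i + k + 1)).1)
  have h1 : sVineDensity C (N + 1) (stdCDFPi z) =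
      ∏ k ∈ Finset.range N, ∏ i ∈ Finset.range (N - k), f k i := by
    rw [sVineDensity, Finset.prod_range]
    refine Finset.prod_congr rfl fun k _ => ?_
    rw [Finset.prod_range]
    refine Finset.prod_congr rfl fun i _ => ?_
    have h := rosenblatt_stdCDF ha hC w k i
    simp only [hz]
    push_cast
    rw [h.1, h.2]
  have h2 : ∏ j : Fin (N + 1), stdPDF (latticeFilter a w j j).1 / (stdPDF (z j) * latticeScale a j) =
      ∏ j ∈ Finset.range (N + 1),
        stdPDF (latticeFilter a w j j).1 / (stdPDF (w j) * latticeScale a j) := by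
    rw [Finset.prod_range]
    refine Finset.prod_congr rfl fun j _ => ?_
    rw [hw, extendByZero_natCast z j.2]
  -- The pairs (lag, first position) are regrouped by the position of the later member; position `0`
  -- is never the later member and contributes the factor `1`.
  rw [h1, h2, ← Finset.prod_range_diag_flip, Finset.prod_range_succ' _ N]
  have h0 : stdPDF (latticeFilter a w 0 (0 : ℕ)).1 / (stdPDF (w (0 : ℕ)) * latticeScale a 0) = 1 := by
    simp [latticeFilter, latticeScale, (stdPDF_pos (w 0)).ne']
  rw [h0, mul_one]
  refine Finset.prod_congr rfl fun m _ => ?_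
  rw [← prod_density_eq_div ha hC]
  refine Finset.prod_congr rfl fun k hk => ?_
  have hk' : k ≤ m := by simpa [Nat.lt_succ_iff] using hk
  simp only [f]
  push_cast [hk']
  rw [show (m : ℤ) + 1 - k - 1 = m - k by ring, show (m : ℤ) - k + k + 1 = m + 1 by ring]

end Density

/-! ### Change of variables by the innovation matrix. -/

section InnovationMatrix

/-- The matrix of the linear map that sends `z` to its forward prediction errors of full order. -/
noncomputable def innovationMatrix (a : ℕ → ℝ) (n : ℕ) : Matrix (Fin n) (Fin n) ℝ :=
  Matrix.of fun j i => (latticeFilter a (fun t : ℤ => if t = (i : ℕ) then (1 : ℝ) else 0) j j).1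

/-- Stated for vector-valued sequences because it serves twice: for real windows, and for the
process viewed as a sequence in `L²`. By linearity both reduce to the universal sequence of standard
basis vectors. -/
theorem sum_innovationMatrix_smul {E : Type*} [AddCommGroup E] [Module ℝ E] (a : ℕ → ℝ) (n : ℕ)
    (V : ℤ → E) (j : Fin n) :
    ∑ i, innovationMatrix a n j i • V (i : ℕ) = (latticeFilter a V j j).1 := by
  let v : ℤ → Fin n → ℝ := fun t i => if t = (i : ℕ) then 1 else 0
  let L : (Fin n → ℝ) →ₗ[ℝ] E :=
    ∑ i, (LinearMap.proj i : (Fin n → ℝ) →ₗ[ℝ] ℝ).smulRight (V (i : ℕ))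
  have hL : ∀ e, L e = ∑ i, e i • V (i : ℕ) := fun e => by simp [L]
  have h1 : (latticeFilter a V j j).1 = L (latticeFilter a v j j).1 := by
    refine Eq.trans ?_ (congrArg Prod.fst (map_latticeFilter L a v j j))
    refine (latticeFilter_congr a j j).1 fun s hs1 hs2 => ?_
    rw [sub_self] at hs1
    lift s to ℕ using hs1
    have hs : s < n := by have := j.2; omega
    rw [hL, Finset.sum_eq_single ⟨s, hs⟩]
    · simp [v]
    · intro i _ hi
      have : s ≠ i := fun h => hi (Fin.ext h.symm)
      simp [v, this]
    · simp
  rw [h1, hL]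
  refine Finset.sum_congr rfl fun i _ => ?_
  congr 1
  have := congrArg Prod.fst (map_latticeFilter (LinearMap.proj i : (Fin n → ℝ) →ₗ[ℝ] ℝ) a v j j)
  exact this

theorem innovationMatrix_mulVec (a : ℕ → ℝ) {n : ℕ} (z : Fin n → ℝ) (j : Fin n) :
    (innovationMatrix a n).mulVec z j = (latticeFilter a (extendByZero z) j j).1 := by
  rw [← sum_innovationMatrix_smul a n]
  simp [Matrix.mulVec, dotProduct, extendByZero_natCast]

theorem det_innovationMatrix (a : ℕ → ℝ) (n : ℕ) :
    (innovationMatrix a n).det = ∏ j : Fin n, (latticeScale a j)⁻¹ := by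
  rw [Matrix.det_of_isLowerTriangular]
  · refine Finset.prod_congr rfl fun j _ => ?_
    rw [innovationMatrix, Matrix.of_apply, latticeFilter_fst_eq_smul]
    · simp
    · intro s _ h2
      simp [h2.ne]
  · intro j i hij
    have hij : (j : ℕ) < i := hij
    rw [innovationMatrix, Matrix.of_apply, (latticeFilter_congr a (z' := fun _ => 0) _ _).1,
      latticeFilter_zero]
    · rfl
    · intro s _ h2
      have : s ≠ (i : ℕ) := by omega
      simp [this]

theorem det_innovationMatrix_pos {a : ℕ → ℝ} (ha : ∀ k, a k ∈ Set.Ioo (-1 : ℝ) 1) (n : ℕ) :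
    0 < (innovationMatrix a n).det := by
  rw [det_innovationMatrix]
  exact Finset.prod_pos fun j _ => inv_pos.2 (latticeScale_pos ha j)

theorem stdNormal_eq_withDensity (n : ℕ) :
    stdNormal n = volume.withDensity fun z => ENNReal.ofReal (∏ i, stdPDF (z i)) := by
  refine Measure.pi_eq fun s hs => ?_
  have hfi : ∀ i, Integrable ((s i).indicator stdPDF) := fun i =>
    integrable_stdPDF.indicator (hs i)
  have hind : (Set.univ.pi s).indicator (fun z : Fin n → ℝ => ∏ i, stdPDF (z i)) =
      fun z => ∏ i, (s i).indicator stdPDF (z i) := by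
    funext z
    by_cases hz : z ∈ Set.univ.pi s
    · rw [Set.indicator_of_mem hz]
      exact Finset.prod_congr rfl fun i _ =>
        (Set.indicator_of_mem (hz i (Set.mem_univ i)) _).symm
    · rw [Set.indicator_of_notMem hz]
      simp only [Set.mem_univ_pi, not_forall] at hz
      obtain ⟨i, hi⟩ := hz
      exact (Finset.prod_eq_zero (Finset.mem_univ i) (Set.indicator_of_notMem hi _)).symm
  have hs' := MeasurableSet.univ_pi hs
  have hint : Integrable fun z : Fin n → ℝ => ∏ i, (s i).indicator stdPDF (z i) :=
    Integrable.fintype_prod hfi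
  have hnn : ∀ i x, 0 ≤ (s i).indicator stdPDF x := fun i x =>
    Set.indicator_nonneg (fun x _ => (stdPDF_pos x).le) x
  rw [withDensity_apply _ hs', ← ofReal_integral_eq_lintegral_ofReal, ← integral_indicator hs',
    hind, integral_fintype_prod_volume_eq_prod, ENNReal.ofReal_prod_of_nonneg]
  · refine Finset.prod_congr rfl fun i _ => ?_
    rw [gaussianReal_apply_eq_integral _ one_ne_zero, integral_indicator (hs i)]
    rfl
  · exact fun i _ => integral_nonneg (hnn i)
  · exact (integrable_indicator_iff hs').1 (hind ▸ hint)
  · exact Filter.Eventually.of_forall fun z => Finset.prod_nonneg fun i _ => (stdPDF_pos _).le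

theorem measurableEmbedding_mulVec {n : ℕ} {M : Matrix (Fin n) (Fin n) ℝ} (hM : M.det ≠ 0) :
    MeasurableEmbedding M.mulVec := by
  refine Measurable.measurableEmbedding ?_ (Matrix.mulVec_injective_of_isUnit
    ((Matrix.isUnit_iff_isUnit_det _).2 hM.isUnit))
  exact (LinearMap.continuous_of_finiteDimensional (Matrix.toLin' M)).measurable

/-- Multiplying by the standard normal density cancels the denominators and leaves `det M ∏ φ((M
z)ᵢ)`; the Jacobian of the linear substitution removes the determinant. -/
theorem withDensity_map_mulVec {n : ℕ} {M : Matrix (Fin n) (Fin n) ℝ} (hM : 0 < M.det) :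
    ((stdNormal n).withDensity fun z =>
      ENNReal.ofReal (M.det * ∏ i, stdPDF (M.mulVec z i) / stdPDF (z i))).map M.mulVec =
      stdNormal n := by
  have hmv : Measurable M.mulVec := (measurableEmbedding_mulVec hM.ne').measurable
  have hφ := continuous_stdPDF.measurable
  have h1 : (stdNormal n).withDensity (fun z =>
      ENNReal.ofReal (M.det * ∏ i, stdPDF (M.mulVec z i) / stdPDF (z i))) =
      volume.withDensity
        ((fun z => ENNReal.ofReal (M.det * ∏ i, stdPDF (z i))) ∘ M.mulVec) := by
    rw [stdNormal_eq_withDensity, ← withDensity_mul₀ (Measurable.aemeasurable (by fun_prop))]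
    · congr 1
      funext z
      rw [Pi.mul_apply, ← ENNReal.ofReal_mul (Finset.prod_nonneg fun i _ => (stdPDF_pos _).le),
        Function.comp_apply, mul_left_comm, ← Finset.prod_mul_distrib]
      congr 2
      exact Finset.prod_congr rfl fun i _ => mul_div_cancel₀ _ (stdPDF_pos _).ne'
    · refine Measurable.aemeasurable ?_
      have : ∀ i, Measurable fun z => M.mulVec z i := fun i => (measurable_pi_apply i).comp hmv
      fun_prop
  rw [h1, ← (measurableEmbedding_mulVec hM.ne').withDensity_map]
  have h2 := Real.map_matrix_volume_pi_eq_smul_volume_pi hM.ne'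
  change Measure.map M.mulVec volume = _ at h2
  rw [h2, withDensity_smul_measure, ← withDensity_smul _ (by fun_prop), stdNormal_eq_withDensity]
  congr 1
  funext z
  rw [Pi.smul_apply, smul_eq_mul, ← ENNReal.ofReal_mul (abs_nonneg _),
    abs_of_pos (inv_pos.2 hM), inv_mul_cancel_left₀ hM.ne']

/-- A law is pushed forward to the standard normal law by the innovation matrix iff it has the
s-vine density after transformation to uniform margins. -/
theorem eq_withDensity_sVineDensity_iff {C : ℕ → Copula 2} {a : ℕ → ℝ}
    (ha : ∀ k, a k ∈ Set.Ioo (-1 : ℝ) 1)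
    (hC : ∀ k, (C (k + 1)).law = (bivariateNormal (a k)).map stdCDFPi) {n : ℕ}
    (μ : Measure (Fin n → ℝ)) :
    (μ = (stdNormal n).withDensity fun z => ENNReal.ofReal (sVineDensity C n (stdCDFPi z))) ↔
      μ.map (innovationMatrix a n).mulVec = stdNormal n := by
  have hM := det_innovationMatrix_pos ha n
  have h : (fun z : Fin n → ℝ => ENNReal.ofReal (sVineDensity C n (stdCDFPi z))) = fun z =>
      ENNReal.ofReal ((innovationMatrix a n).det *
        ∏ i, stdPDF ((innovationMatrix a n).mulVec z i) / stdPDF (z i)) := by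
    funext z
    rw [sVineDensity_stdCDFPi ha hC, det_innovationMatrix, ← Finset.prod_mul_distrib]
    congr 1
    refine Finset.prod_congr rfl fun j _ => ?_
    rw [innovationMatrix_mulVec, ← div_div, div_eq_inv_mul]
  have key := withDensity_map_mulVec hM
  rw [h]
  constructor
  · rintro rfl; exact key
  · intro hμ
    -- Push-forward along an injective measurable embedding determines the measure.
    rw [← (measurableEmbedding_mulVec hM.ne').comap_map μ, hμ]
    nth_rw 1 [← key]
    rw [(measurableEmbedding_mulVec hM.ne').comap_map]

end InnovationMatrix

/-! ### Levinson–Durbin recursion in an inner product space. -/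

section Levinson

variable {H : Type*} [NormedAddCommGroup H] [InnerProductSpace ℝ H]

open scoped InnerProductSpace

/-- The requirement is not circular: errors of order `k` use only the coefficients below `k`. The
errors are built first, each step computing its own coefficient. -/
theorem exists_latticeFilter_coeff (V : ℤ → H) :
    ∃ a : ℕ → ℝ, ∀ k : ℕ,
      a k = ⟪(latticeFilter a V k 0).2, (latticeFilter a V k (k + 1)).1⟫_ℝ := by
  let st : ℕ → ℤ → H × H := Nat.rec (fun t => (V t, V t)) fun k f t =>
    let α : ℝ := ⟪(f 0).2, (f (k + 1)).1⟫_ℝ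
    ((√(1 - α ^ 2))⁻¹ • ((f t).1 - α • (f (t - k - 1)).2),
      (√(1 - α ^ 2))⁻¹ • ((f t).2 - α • (f (t + k + 1)).1))
  let a : ℕ → ℝ := fun k => ⟪(st k 0).2, (st k (k + 1)).1⟫_ℝ
  have h : ∀ k t, latticeFilter a V k t = st k t := by
    intro k
    induction k with
    | zero => intro t; rfl
    | succ k ih => intro t; simp only [latticeFilter, ih]; rfl
  exact ⟨a, fun k => by rw [h, h]⟩

variable {V : ℤ → H}

/-- The three types of inner products have to be carried together, since one lattice step mixes
forward and backward errors. This is why one coefficient per order, computed at time `0`, serves all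
times. -/
theorem inner_latticeFilter_shift (hV : ∀ s t h, ⟪V (s + h), V (t + h)⟫_ℝ = ⟪V s, V t⟫_ℝ)
    (a : ℕ → ℝ) (k : ℕ) (s t h : ℤ) :
    ⟪(latticeFilter a V k (s + h)).1, (latticeFilter a V k (t + h)).1⟫_ℝ =
        ⟪(latticeFilter a V k s).1, (latticeFilter a V k t).1⟫_ℝ ∧
      ⟪(latticeFilter a V k (s + h)).2, (latticeFilter a V k (t + h)).2⟫_ℝ =
        ⟪(latticeFilter a V k s).2, (latticeFilter a V k t).2⟫_ℝ ∧
      ⟪(latticeFilter a V k (s + h)).2, (latticeFilter a V k (t + h)).1⟫_ℝ =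
        ⟪(latticeFilter a V k s).2, (latticeFilter a V k t).1⟫_ℝ := by
  induction k generalizing s t with
  | zero => exact ⟨hV s t h, hV s t h, hV s t h⟩
  | succ k ih =>
    have e1 : ∀ t : ℤ, t + h - k - 1 = t - k - 1 + h := fun t => by ring
    have e2 : ∀ t : ℤ, t + h + k + 1 = t + k + 1 + h := fun t => by ring
    have ih' : ∀ s t, ⟪(latticeFilter a V k (s + h)).1, (latticeFilter a V k (t + h)).2⟫_ℝ =
        ⟪(latticeFilter a V k s).1, (latticeFilter a V k t).2⟫_ℝ := fun s t => by
      rw [real_inner_comm, (ih t s).2.2, real_inner_comm]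
    simp only [latticeFilter, e1, e2, inner_smul_left, inner_smul_right, inner_sub_left,
      inner_sub_right, (ih _ _).1, (ih _ _).2.1, (ih _ _).2.2, ih', and_self]

theorem latticeFilter_sub_smul_mem_span (a : ℕ → ℝ) (V : ℤ → H) (k : ℕ) (t : ℤ) :
    (latticeFilter a V k t).1 - (latticeScale a k)⁻¹ • V t ∈
        Submodule.span ℝ (V '' Set.Ico (t - k) t) ∧
      (latticeFilter a V k t).2 - (latticeScale a k)⁻¹ • V t ∈
        Submodule.span ℝ (V '' Set.Ioc t (t + k)) := by
  induction k generalizing t with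
  | zero => simp [latticeFilter, latticeScale]
  | succ k ih =>
    have hs : (latticeScale a (k + 1))⁻¹ = (√(1 - a k ^ 2))⁻¹ * (latticeScale a k)⁻¹ := by
      rw [latticeScale, latticeScale, Finset.prod_range_succ, mul_inv, mul_comm]
    have hmono : ∀ {I J : Set ℤ}, I ⊆ J →
        Submodule.span ℝ (V '' I) ≤ Submodule.span ℝ (V '' J) :=
      fun h => Submodule.span_mono (Set.image_mono h)
    have hmem : ∀ {I : Set ℤ} {s : ℤ}, s ∈ I → V s ∈ Submodule.span ℝ (V '' I) :=
      fun h => Submodule.subset_span (Set.mem_image_of_mem V h)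
    push_cast
    constructor
    · have h1 := hmono (J := Set.Ico (t - (k + 1)) t) (fun x hx => by
        simp only [Set.mem_Ico] at hx ⊢; omega) (ih t).1
      have h2 := hmono (J := Set.Ico (t - (k + 1)) t) (fun x hx => by
        simp only [Set.mem_Ico, Set.mem_Ioc] at hx ⊢; omega) (ih (t - k - 1)).2
      have h3 := hmem (I := Set.Ico (t - (k + 1)) t) (s := t - k - 1)
        (by simp only [Set.mem_Ico]; omega)
      have h4 := Submodule.add_mem _ h2 (Submodule.smul_mem _ (latticeScale a k)⁻¹ h3)
      rw [sub_add_cancel] at h4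
      have h5 := Submodule.smul_mem _ (√(1 - a k ^ 2))⁻¹
        (Submodule.sub_mem _ h1 (Submodule.smul_mem _ (a k) h4))
      convert! h5 using 1
      simp only [latticeFilter, hs]
      module
    · have h1 := hmono (J := Set.Ioc t (t + (k + 1))) (fun x hx => by
        simp only [Set.mem_Ioc] at hx ⊢; omega) (ih t).2
      have h2 := hmono (J := Set.Ioc t (t + (k + 1))) (fun x hx => by
        simp only [Set.mem_Ico, Set.mem_Ioc] at hx ⊢; omega) (ih (t + k + 1)).1
      have h3 := hmem (I := Set.Ioc t (t + (k + 1))) (s := t + k + 1)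
        (by simp only [Set.mem_Ioc]; omega)
      have h4 := Submodule.add_mem _ h2 (Submodule.smul_mem _ (latticeScale a k)⁻¹ h3)
      rw [sub_add_cancel] at h4
      have h5 := Submodule.smul_mem _ (√(1 - a k ^ 2))⁻¹
        (Submodule.sub_mem _ h1 (Submodule.smul_mem _ (a k) h4))
      convert! h5 using 1
      simp only [latticeFilter, hs]
      module

theorem inner_eq_zero_of_mem_span_image {x w : H} {I : Set ℤ} (hx : ∀ s ∈ I, ⟪x, V s⟫_ℝ = 0)
    (hw : w ∈ Submodule.span ℝ (V '' I)) : ⟪x, w⟫_ℝ = 0 := by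
  induction hw using Submodule.span_induction with
  | mem y hy => obtain ⟨s, hs, rfl⟩ := hy; exact hx s hs
  | zero => exact inner_zero_right x
  | add y z _ _ hy hz => rw [inner_add_right, hy, hz, add_zero]
  | smul c y _ hy => rw [inner_smul_right, hy, mul_zero]

theorem inner_sub_smul_self {x y : H} {α : ℝ} (hx : ⟪x, x⟫_ℝ = 1) (hy : ⟪y, y⟫_ℝ = 1)
    (hxy : ⟪x, y⟫_ℝ = α) : ⟪x - α • y, x - α • y⟫_ℝ = 1 - α ^ 2 := by
  have hyx : ⟪y, x⟫_ℝ = α := by rw [real_inner_comm, hxy]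
  simp only [inner_sub_left, inner_sub_right, real_inner_smul_left, real_inner_smul_right, hx, hy,
    hxy, hyx]
  ring

/-- The lattice recursion with the partial correlations as coefficients produces normalized
prediction errors that are orthogonal to the predictors. -/
theorem latticeFilter_orthogonal (hli : LinearIndependent ℝ V) (hone : ∀ t, ⟪V t, V t⟫_ℝ = 1)
    (hV : ∀ s t h, ⟪V (s + h), V (t + h)⟫_ℝ = ⟪V s, V t⟫_ℝ) {a : ℕ → ℝ}
    (ha : ∀ k : ℕ, a k = ⟪(latticeFilter a V k 0).2, (latticeFilter a V k (k + 1)).1⟫_ℝ) (k : ℕ) :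
    (∀ l < k, a l ∈ Set.Ioo (-1 : ℝ) 1) ∧ ∀ t : ℤ,
      ⟪(latticeFilter a V k t).1, (latticeFilter a V k t).1⟫_ℝ = 1 ∧
      ⟪(latticeFilter a V k t).2, (latticeFilter a V k t).2⟫_ℝ = 1 ∧
      (∀ s ∈ Set.Ico (t - k) t, ⟪(latticeFilter a V k t).1, V s⟫_ℝ = 0) ∧
      (∀ s ∈ Set.Ioc t (t + k), ⟪(latticeFilter a V k t).2, V s⟫_ℝ = 0) := by
  induction k with
  | zero =>
    refine ⟨by simp, fun t => ⟨hone t, hone t, fun s hs => ?_, fun s hs => ?_⟩⟩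
    · simp only [Set.mem_Ico] at hs; omega
    · simp only [Set.mem_Ioc] at hs; omega
  | succ k ih =>
    obtain ⟨hIoo, ih⟩ := ih
    have hscale : latticeScale a k ≠ 0 :=
      (Finset.prod_pos fun l hl => sqrt_one_sub_sq_pos (hIoo l (Finset.mem_range.1 hl))).ne'
    have hBF : ∀ b, ⟪(latticeFilter a V k b).2, (latticeFilter a V k (b + k + 1)).1⟫_ℝ = a k :=
      fun b => by
        rw [ha, ← (inner_latticeFilter_shift hV a k 0 (k + 1) b).2.2]
        congr 3 <;> ring
    have hFB : ∀ b, ⟪(latticeFilter a V k (b + k + 1)).1, (latticeFilter a V k b).2⟫_ℝ = a k :=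
      fun b => by rw [real_inner_comm, hBF]
    -- The residual has squared norm `1 - a k ^ 2`. If it vanished, `V (k + 1)` would lie in the
    -- span of `V 0, …, V k`, against linear independence.
    have hlt : a k ^ 2 < 1 := by
      have hne : (latticeFilter a V k (0 + k + 1)).1 - a k • (latticeFilter a V k 0).2 ≠ 0 := by
        intro h0
        have h1 := (latticeFilter_sub_smul_mem_span a V k (0 + k + 1)).1
        have h2 := (latticeFilter_sub_smul_mem_span a V k 0).2
        have hmono : ∀ {I : Set ℤ}, I ⊆ Set.Icc 0 (k : ℤ) →
            Submodule.span ℝ (V '' I) ≤ Submodule.span ℝ (V '' Set.Icc 0 (k : ℤ)) :=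
          fun h => Submodule.span_mono (Set.image_mono h)
        have h1 := hmono (fun x hx => by
          simp only [Set.mem_Icc, Set.mem_Ico] at hx ⊢; omega) h1
        have h2 := hmono (fun x hx => by
          simp only [Set.mem_Icc, Set.mem_Ioc] at hx ⊢; omega) h2
        have h3 : V 0 ∈ Submodule.span ℝ (V '' Set.Icc 0 (k : ℤ)) :=
          Submodule.subset_span (Set.mem_image_of_mem V (by simp))
        have h4 := Submodule.add_mem _ h2 (Submodule.smul_mem _ (latticeScale a k)⁻¹ h3)
        rw [sub_add_cancel] at h4
        have h5 := Submodule.smul_mem _ (latticeScale a k)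
          (Submodule.sub_mem _ (Submodule.smul_mem _ (a k) h4) h1)
        rw [← sub_eq_zero.1 h0, sub_sub_cancel, smul_inv_smul₀ hscale] at h5
        refine hli.notMem_span_image (s := Set.Icc 0 (k : ℤ)) ?_ h5
        simp only [Set.mem_Icc]; omega
      have h := real_inner_self_pos.2 hne
      rw [inner_sub_smul_self (ih _).1 (ih _).2.1 (hFB 0)] at h
      linarith
    have hk : a k ∈ Set.Ioo (-1 : ℝ) 1 := abs_lt.1 ((sq_lt_one_iff_abs_lt_one _).1 hlt)
    have hss : √(1 - a k ^ 2) ^ 2 = 1 - a k ^ 2 := Real.sq_sqrt (by linarith)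
    have hs := (sqrt_one_sub_sq_pos hk).ne'
    have hb : ∀ t : ℤ, t - k - 1 + k + 1 = t := fun t => by ring
    have hFB' : ∀ t, ⟪(latticeFilter a V k t).1, (latticeFilter a V k (t - k - 1)).2⟫_ℝ = a k :=
      fun t => by simpa only [hb] using hFB (t - k - 1)
    have hFF := fun t => inner_sub_smul_self (ih t).1 (ih _).2.1 (hFB' t)
    have hBB := fun t => inner_sub_smul_self (ih t).2.1 (ih _).1 (hBF t)
    refine ⟨fun l hl => ?_, fun t => ⟨?_, ?_, fun s hs => ?_, fun s hs => ?_⟩⟩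
    · rcases Nat.lt_succ_iff_lt_or_eq.1 hl with h | rfl
      exacts [hIoo l h, hk]
    · simp only [latticeFilter]
      rw [real_inner_smul_left, real_inner_smul_right, hFF, ← mul_assoc, ← mul_inv, ← sq,
        hss]
      exact inv_mul_cancel₀ (sub_pos.2 hlt).ne'
    · simp only [latticeFilter]
      rw [real_inner_smul_left, real_inner_smul_right, hBB, ← mul_assoc, ← mul_inv, ← sq,
        hss]
      exact inv_mul_cancel₀ (sub_pos.2 hlt).ne'
    · simp only [latticeFilter]
      push_cast at hs
      rw [real_inner_smul_left, inner_sub_left, real_inner_smul_left]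
      -- Only the new endpoint needs an argument. Both errors are orthogonal to the interior
      -- predictors, so pairing them with the backward error amounts to pairing with the scaled
      -- endpoint: `a k = ⟪F, V⟫ / scale` and `1 = ⟪B, V⟫ / scale`, whence `⟪F, V⟫ = a k * ⟪B, V⟫`.
      rcases eq_or_ne s (t - k - 1) with rfl | hne
      · have hmem := (latticeFilter_sub_smul_mem_span a V k (t - k - 1)).2
        have h1 : ⟪(latticeFilter a V k t).1, _⟫_ℝ = 0 :=
          inner_eq_zero_of_mem_span_image (fun s hs => (ih t).2.2.1 s (by
            simp only [Set.mem_Ico, Set.mem_Ioc] at hs ⊢; omega)) hmem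
        have h2 : ⟪(latticeFilter a V k (t - k - 1)).2, _⟫_ℝ = 0 :=
          inner_eq_zero_of_mem_span_image (ih _).2.2.2 hmem
        rw [inner_sub_right, real_inner_smul_right, sub_eq_zero] at h1 h2
        rw [hFB'] at h1
        rw [(ih _).2.1] at h2
        have h3 : (latticeScale a k)⁻¹ * (⟪(latticeFilter a V k t).1, V (t - k - 1)⟫_ℝ -
            a k * ⟪(latticeFilter a V k (t - k - 1)).2, V (t - k - 1)⟫_ℝ) = 0 := by
          rw [mul_sub, ← h1, mul_left_comm, ← h2]; ring
        rw [(mul_eq_zero.1 h3).resolve_left (inv_ne_zero hscale), mul_zero]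
      · simp only [Set.mem_Ico] at hs
        rw [(ih t).2.2.1 s (by simp only [Set.mem_Ico]; omega),
          (ih (t - k - 1)).2.2.2 s (by simp only [Set.mem_Ioc]; omega)]
        simp
    · simp only [latticeFilter]
      push_cast at hs
      rw [real_inner_smul_left, inner_sub_left, real_inner_smul_left]
      rcases eq_or_ne s (t + k + 1) with rfl | hne
      · have hmem := (latticeFilter_sub_smul_mem_span a V k (t + k + 1)).1
        have h1 : ⟪(latticeFilter a V k t).2, _⟫_ℝ = 0 :=
          inner_eq_zero_of_mem_span_image (fun s hs => (ih t).2.2.2 s (by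
            simp only [Set.mem_Ico, Set.mem_Ioc] at hs ⊢; omega)) hmem
        have h2 : ⟪(latticeFilter a V k (t + k + 1)).1, _⟫_ℝ = 0 :=
          inner_eq_zero_of_mem_span_image (ih _).2.2.1 hmem
        rw [inner_sub_right, real_inner_smul_right, sub_eq_zero] at h1 h2
        rw [hBF] at h1
        rw [(ih _).1] at h2
        have h3 : (latticeScale a k)⁻¹ * (⟪(latticeFilter a V k t).2, V (t + k + 1)⟫_ℝ -
            a k * ⟪(latticeFilter a V k (t + k + 1)).1, V (t + k + 1)⟫_ℝ) = 0 := by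
          rw [mul_sub, ← h1, mul_left_comm, ← h2]; ring
        rw [(mul_eq_zero.1 h3).resolve_left (inv_ne_zero hscale), mul_zero]
      · simp only [Set.mem_Ioc] at hs
        rw [(ih t).2.2.2 s (by simp only [Set.mem_Ioc]; omega),
          (ih (t + k + 1)).2.2.1 s (by simp only [Set.mem_Ico]; omega)]
        simp

/-- The error of order `j` at time `j` is orthogonal to `V 0, …, V (j - 1)`, whose span contains all
earlier errors: Gram–Schmidt starting at time `0`. -/
theorem exists_latticeFilter_orthonormal (hli : LinearIndependent ℝ V)
    (hone : ∀ t, ⟪V t, V t⟫_ℝ = 1) (hV : ∀ s t h, ⟪V (s + h), V (t + h)⟫_ℝ = ⟪V s, V t⟫_ℝ) :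
    ∃ a : ℕ → ℝ, (∀ k, a k ∈ Set.Ioo (-1 : ℝ) 1) ∧ ∀ i j : ℕ,
      ⟪(latticeFilter a V i i).1, (latticeFilter a V j j).1⟫_ℝ = if i = j then 1 else 0 := by
  obtain ⟨a, ha⟩ := exists_latticeFilter_coeff V
  have h := latticeFilter_orthogonal hli hone hV ha
  have hlt : ∀ i j : ℕ, i < j →
      ⟪(latticeFilter a V j j).1, (latticeFilter a V i i).1⟫_ℝ = 0 := fun i j hij => by
    have hort := ((h j).2 j).2.2.1
    have h1 := inner_eq_zero_of_mem_span_image (fun s hs => hort s (by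
      simp only [Set.mem_Ico] at hs ⊢; omega)) (latticeFilter_sub_smul_mem_span a V i i).1
    rwa [inner_sub_right, real_inner_smul_right, hort i (by simp [hij]), mul_zero,
      sub_zero] at h1
  refine ⟨a, fun k => (h (k + 1)).1 k k.lt_succ_self, fun i j => ?_⟩
  rcases lt_trichotomy i j with hij | rfl | hij
  · rw [real_inner_comm, hlt i j hij, if_neg hij.ne]
  · rw [((h i).2 i).1, if_pos rfl]
  · rw [hlt j i hij, if_neg hij.ne']

end Levinson

/-! ### Absolute continuity, covariance and Gaussian laws. -/

section GaussianLaws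

variable {Ω : Type*} [MeasurableSpace Ω] {P : Measure Ω}

theorem absolutelyContinuous_map_of_surjective {E F : Type*} [NormedAddCommGroup E]
    [NormedSpace ℝ E] [FiniteDimensional ℝ E] [MeasurableSpace E] [BorelSpace E]
    [NormedAddCommGroup F] [NormedSpace ℝ F] [FiniteDimensional ℝ F] [MeasurableSpace F]
    [BorelSpace F] {μ ν : Measure E} [μ.IsAddHaarMeasure] {ρ : Measure F} [ρ.IsAddHaarMeasure]
    (h : ν ≪ μ) {L : E →ₗ[ℝ] F} (hL : Function.Surjective L) : ν.map L ≪ ρ := by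
  obtain ⟨c, -, hc⟩ := L.exists_map_addHaar_eq_smul_addHaar μ ρ hL
  refine (h.map (LinearMap.continuous_of_finiteDimensional L).measurable).trans ?_
  rw [hc]
  exact Measure.smul_absolutelyContinuous

theorem variance_ne_zero_of_absolutelyContinuous {Z : Ω → ℝ} (hZ : HasGaussianLaw Z P)
    (h : P.map Z ≪ volume) : Var[Z; P] ≠ 0 := by
  intro h0
  rw [hZ.map_eq_gaussianReal, h0, Real.toNNReal_zero, gaussianReal_zero_var] at h
  simpa using! h (Real.volume_singleton (a := ∫ ω, Z ω ∂P))

/-- A kernel vector of the covariance matrix is a nonzero functional whose image has variance zero,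
hence is a point mass. But a surjective linear image of an absolutely continuous law is absolutely
continuous. -/
theorem isUnit_covariance_of_absolutelyContinuous {ι : Type*} [Fintype ι] [DecidableEq ι]
    {X : ι → Ω → ℝ} (hX : HasGaussianLaw (fun ω i => X i ω) P)
    (h : P.map (fun ω i => X i ω) ≪ volume) :
    IsUnit (Matrix.of fun s t : ι => cov[X s, X t; P]) := by
  have := hX.isProbabilityMeasure
  rw [Matrix.isUnit_iff_isUnit_det, isUnit_iff_ne_zero]
  intro hdet
  obtain ⟨c, hc, hS⟩ := Matrix.exists_mulVec_eq_zero_iff.2 hdet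
  obtain ⟨i, hi⟩ := Function.ne_iff.1 hc
  let L : (ι → ℝ) →L[ℝ] ℝ := ∑ i, c i • ContinuousLinearMap.proj i
  have hL : ∀ x, L x = ∑ i, c i * x i := fun x => by simp [L]
  have hsurj : Function.Surjective L.toLinearMap := fun r => by
    refine ⟨Pi.single i (r / c i), ?_⟩
    change L _ = r
    rw [hL, Finset.sum_eq_single i]
    · rw [Pi.single_eq_same, mul_div_cancel₀ _ hi]
    · intro j _ hj; rw [Pi.single_eq_of_ne hj, mul_zero]
    · simp
  have hac : (P.map fun ω i => X i ω).map L ≪ volume :=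
    absolutelyContinuous_map_of_surjective h hsurj
  have hmeas := hX.aemeasurable
  rw [AEMeasurable.map_map_of_aemeasurable L.continuous.measurable.aemeasurable hmeas] at hac
  refine variance_ne_zero_of_absolutelyContinuous (hX.map L) hac ?_
  have hX2 : ∀ j, MemLp (fun ω => c j * X j ω) 2 P := fun j => (hX.eval j).memLp_two.const_mul _
  have h1 : L ∘ (fun ω i => X i ω) = fun ω => ∑ i, c i * X i ω := funext fun ω => hL _
  rw [h1, variance_fun_sum hX2]
  have h2 : ∀ s, ∑ t, cov[fun ω => c s * X s ω, fun ω => c t * X t ω; P] = 0 := fun s => by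
    have := congrFun hS s
    simp only [Matrix.mulVec, dotProduct, Matrix.of_apply, Pi.zero_apply] at this
    simp only [covariance_const_mul_left, covariance_const_mul_right]
    rw [← mul_zero (c s), ← this, Finset.mul_sum]
    exact Finset.sum_congr rfl fun t _ => by ring
  exact Finset.sum_eq_zero fun s _ => h2 s

instance isGaussian_stdNormal (n : ℕ) : IsGaussian (stdNormal n) := by
  have h := map_pi_eq_stdGaussian (ι := Fin n)
  have h2 : stdNormal n = (stdGaussian (EuclideanSpace ℝ (Fin n))).map
      (EuclideanSpace.equiv (Fin n) ℝ) := by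
    rw [← h, Measure.map_map (by fun_prop) (by fun_prop)]
    exact Measure.map_id.symm
  rw [h2]
  infer_instance

theorem map_eq_stdNormal {n : ℕ} {W : Fin n → Ω → ℝ} (hW : HasGaussianLaw (fun ω i => W i ω) P)
    (hmean : ∀ i, ∫ ω, W i ω ∂P = 0) (hcov : ∀ i j, cov[W i, W j; P] = if i = j then 1 else 0) :
    P.map (fun ω i => W i ω) = stdNormal n := by
  have := hW.isProbabilityMeasure
  have hind := hW.iIndepFun_of_covariance_eq_zero fun i j hij => by rw [hcov, if_neg hij]
  rw [(iIndepFun_iff_map_fun_eq_pi_map fun i => (hW.eval i).aemeasurable).1 hind]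
  congr 1
  funext i
  rw [(hW.eval i).map_eq_gaussianReal, hmean, ← covariance_self (hW.eval i).aemeasurable, hcov,
    if_pos rfl, Real.toNNReal_one]

end GaussianLaws

/-! ### Stationarity and window laws. -/

section Stationary

variable {Ω : Type*} [MeasurableSpace Ω] {P : Measure Ω} {X : ℤ → Ω → ℝ}

theorem IsStrictlyStationary.identDistrib (h : IsStrictlyStationary X P) (t : ℤ) :
    IdentDistrib (X t) (X 0) P P := by
  have := (h 1 (fun _ => 0) t).comp (measurable_pi_apply 0)
  simpa [Function.comp_def] using! this

theorem IsStrictlyStationary.identDistrib_pair (h : IsStrictlyStationary X P) (s t r : ℤ) :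
    IdentDistrib (fun ω => (X (s + r) ω, X (t + r) ω)) (fun ω => (X s ω, X t ω)) P P := by
  have := (h 2 ![s, t] r).comp
    (by fun_prop : Measurable fun x : Fin 2 → ℝ => (x 0, x 1))
  simpa [Function.comp_def] using! this

theorem IsStrictlyStationary.windowLaw_eq (h : IsStrictlyStationary X P) (t : ℤ) (n : ℕ) :
    windowLaw X P t n = windowLaw X P 0 n := by
  have := (h n (fun i => (0 : ℤ) + (i : ℕ)) t).map_eq
  rw [windowLaw, windowLaw, ← this]
  congr 1
  funext ω i
  rw [zero_add, add_comm]

theorem IsStrictlyStationary.aemeasurable (h : IsStrictlyStationary X P) (t : ℤ) :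
    AEMeasurable (X t) P := (h.identDistrib t).aemeasurable_fst

theorem aemeasurable_window (h : ∀ t, AEMeasurable (X t) P) (t : ℤ) (n : ℕ) :
    AEMeasurable (fun ω (i : Fin n) => X (t + (i : ℕ)) ω) P :=
  aemeasurable_pi_lambda _ fun _ => h _

theorem map_eval_windowLaw (h : ∀ t, AEMeasurable (X t) P) (t : ℤ) (n : ℕ) (i : Fin n) :
    (windowLaw X P t n).map (fun y => y i) = P.map (X (t + (i : ℕ))) := by
  rw [windowLaw, AEMeasurable.map_map_of_aemeasurable (measurable_pi_apply i).aemeasurable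
    (aemeasurable_window h t n)]
  rfl

theorem ProbabilityTheory.HasGaussianLaw.map_eq_of_identDistrib {Y Z : Ω → ℝ}
    (hY : HasGaussianLaw Y P)
    (h : IdentDistrib Z Y P P) : P.map Z = gaussianReal (∫ ω, Y ω ∂P) (Var[Y; P]).toNNReal := by
  rw [h.map_eq, hY.map_eq_gaussianReal]

end Stationary

/-! ### The two directions for processes. -/

section Processes

variable {Ω : Type*} [MeasurableSpace Ω] {P : Measure Ω} {X : ℤ → Ω → ℝ}

theorem ProbabilityTheory.HasGaussianLaw.clm_add_const {ι κ : Type*} [Fintype ι] [Fintype κ]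
    {Z : Ω → ι → ℝ} (hZ : HasGaussianLaw Z P) (L : (ι → ℝ) →L[ℝ] κ → ℝ) (c : κ → ℝ) :
    HasGaussianLaw (fun ω => L (Z ω) + c) P where
  isGaussian_map := by
    have := (hZ.map_fun L).isGaussian_map
    have h : P.map (fun ω => L (Z ω) + c) = (P.map fun ω => L (Z ω)).map fun x => x + c := by
      rw [AEMeasurable.map_map_of_aemeasurable (by fun_prop) (hZ.map_fun L).aemeasurable]
      rfl
    rw [h]
    infer_instance

theorem ProbabilityTheory.IsGaussianProcess.hasGaussianLaw_comp {ι : Type*} [Fintype ι]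
    (hX : IsGaussianProcess X P) (f : ι → ℤ) : HasGaussianLaw (fun ω i => X (f i) ω) P := by
  classical
  let I := Finset.univ.image f
  let L : (I → ℝ) →L[ℝ] ι → ℝ :=
    ContinuousLinearMap.pi fun i => ContinuousLinearMap.proj ⟨f i, by simp [I]⟩
  exact (hX.hasGaussianLaw I).map_fun L

theorem absolutelyContinuous_map_comp_of_injective {ι κ : Type*} [Fintype ι] [Fintype κ]
    {Z : Ω → κ → ℝ} (hZ : AEMeasurable Z P) (h : P.map Z ≪ volume) {e : ι → κ}
    (he : Function.Injective e) : P.map (fun ω i => Z ω (e i)) ≪ volume := by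
  have := absolutelyContinuous_map_of_surjective (ρ := volume) h
    (LinearMap.funLeft_surjective_of_injective ℝ ℝ e he)
  rwa [AEMeasurable.map_map_of_aemeasurable
    (LinearMap.continuous_of_finiteDimensional _).measurable.aemeasurable hZ] at this

theorem absolutelyContinuous_map_of_windowLaw (hX : ∀ t, AEMeasurable (X t) P) {t : ℤ} {n : ℕ}
    (h : windowLaw X P t n ≪ volume) (i : Fin n) : P.map (X (t + (i : ℕ))) ≪ volume := by
  have : (windowLaw X P t n).map (fun y => y i) ≪ volume :=
    absolutelyContinuous_map_of_surjective h
    (LinearMap.proj_surjective (R := ℝ) (φ := fun _ : Fin n => ℝ) i)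
  rwa [map_eval_windowLaw hX] at this

theorem isProbabilityMeasure_windowLaw [IsProbabilityMeasure P] (hX : ∀ t, AEMeasurable (X t) P)
    (t : ℤ) (n : ℕ) : IsProbabilityMeasure (windowLaw X P t n) :=
  Measure.isProbabilityMeasure_map (aemeasurable_window hX t n)

theorem IsNonsingularGaussianProcess.windowLaw_absolutelyContinuous
    (hX : IsNonsingularGaussianProcess X P) (t : ℤ) (n : ℕ) : windowLaw X P t n ≪ volume := by
  classical
  let f : Fin n → ℤ := fun i => t + (i : ℕ)
  have hf : Function.Injective f := fun i j h => Fin.ext (by simpa [f] using h)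
  exact absolutelyContinuous_map_comp_of_injective
    (hX.isGaussianProcess.hasGaussianLaw _).aemeasurable
    (hX.absolutelyContinuous (Finset.univ.image f))
    (e := fun i => (⟨f i, by simp⟩ : (Finset.univ.image f : Finset ℤ)))
    fun i j h => hf (congrArg Subtype.val h)

theorem standardize_eq_smul_add {ι : Type*} (m : ℝ) (v : NNReal) (y : ι → ℝ) :
    standardize m v y = (√v)⁻¹ • y + fun _ => -((√v)⁻¹ * m) := by
  funext i
  simp only [standardize, Pi.add_apply, Pi.smul_apply, smul_eq_mul]
  ring

/-- For a nonsingular stationary Gaussian process there are partial correlations whose innovation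
matrices whiten all standardized windows. -/
theorem exists_map_innovationMatrix_eq_stdNormal [IsProbabilityMeasure P]
    (hst : IsStrictlyStationary X P) (hX : IsNonsingularGaussianProcess X P) {m : ℝ} {v : NNReal}
    (hv : v ≠ 0) (hmarg : ∀ t, P.map (X t) = gaussianReal m v) :
    ∃ a : ℕ → ℝ, (∀ k, a k ∈ Set.Ioo (-1 : ℝ) 1) ∧ ∀ (t : ℤ) (n : ℕ),
      ((windowLaw X P t n).map (standardize m v)).map (innovationMatrix a n).mulVec =
        stdNormal n := by
  have hm := hst.aemeasurable
  have hv0 : (0 : ℝ) < v := by positivity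
  have hs : 0 < √(v : ℝ) := Real.sqrt_pos.2 hv0
  let Y : ℤ → Ω → ℝ := fun t ω => (X t ω - m) / √v
  have hmY : ∀ t, AEMeasurable (Y t) P := fun t => ((hm t).sub_const m).div_const _
  have hYlaw : ∀ t, P.map (Y t) = gaussianReal 0 1 := fun t => by
    rw [← gaussianReal_map_standardize m hv, ← hmarg t,
      AEMeasurable.map_map_of_aemeasurable (by fun_prop) (hm t)]
    rfl
  have hYG : ∀ t, HasGaussianLaw (Y t) P := fun t => ⟨by rw [hYlaw t]; infer_instance⟩
  have hY2 : ∀ t, MemLp (Y t) 2 P := fun t => (hYG t).memLp_two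
  have hYmean : ∀ t, ∫ ω, Y t ω ∂P = 0 := fun t => by
    have := integral_id_gaussianReal (μ := 0) (v := 1)
    rwa [← hYlaw t, integral_map (hmY t) (by fun_prop)] at this
  have hXmean : ∀ t, ∫ ω, X t ω ∂P = m := fun t => by
    have := integral_id_gaussianReal (μ := m) (v := v)
    rwa [← hmarg t, integral_map (hm t) (by fun_prop)] at this
  have hYvar : ∀ t, Var[Y t; P] = 1 := fun t => by
    have := variance_id_gaussianReal (μ := 0) (v := 1)
    rwa [← hYlaw t, variance_map (by fun_prop) (hmY t)] at this
  -- The standardized variables are centred, so their `L²` inner products are covariances and the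
  -- Levinson argument applies.
  let V : ℤ → Lp ℝ 2 P := fun t => (hY2 t).toLp (Y t)
  have hin : ∀ s t, inner ℝ (V s) (V t) = cov[Y s, Y t; P] := fun s t => by
    rw [covariance, L2.inner_def]
    refine integral_congr_ae ?_
    filter_upwards [(hY2 s).coeFn_toLp, (hY2 t).coeFn_toLp] with ω h1 h2
    rw [hYmean, hYmean, sub_zero, sub_zero, h1, h2]
    simp [mul_comm]
  have hcovX : ∀ s t, cov[X s, X t; P] = v * inner ℝ (V s) (V t) := fun s t => by
    rw [hin, covariance, covariance, hXmean, hXmean, hYmean, hYmean, ← integral_const_mul]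
    congr 1
    funext ω
    simp only [Y, sub_zero]
    field_simp
    rw [Real.sq_sqrt hv0.le]
  have hone : ∀ t, inner ℝ (V t) (V t) = (1 : ℝ) := fun t => by
    rw [hin, covariance_self (hmY t), hYvar]
  have hshift : ∀ s t h, inner ℝ (V (s + h)) (V (t + h)) = inner ℝ (V s) (V t) := fun s t h => by
    rw [hin, hin, covariance, covariance, hYmean, hYmean, hYmean, hYmean]
    exact ((hst.identDistrib_pair s t h).comp (by fun_prop : Measurable fun p : ℝ × ℝ =>
      ((p.1 - m) / √v - 0) * ((p.2 - m) / √v - 0))).integral_eq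
  -- The covariance matrix is `v` times the Gram matrix, so a linear relation among the `V t` gives
  -- a kernel vector of an invertible matrix.
  have hli : LinearIndependent ℝ V := by
    classical
    rw [linearIndependent_iff']
    intro I g hg i hi
    have hinj := Matrix.mulVec_injective_of_isUnit (hX.isUnit_covariance I)
    have h0 : (Matrix.of fun s t : I => cov[X s, X t; P]).mulVec (fun t : I => g t) = 0 := by
      funext s
      have h1 : inner ℝ (V s) (∑ t ∈ I, g t • V t) = (0 : ℝ) := by rw [hg, inner_zero_right]
      rw [inner_sum, ← Finset.sum_coe_sort] at h1
      simp only [Matrix.mulVec, dotProduct, Matrix.of_apply, hcovX, Pi.zero_apply, mul_assoc,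
        ← Finset.mul_sum]
      rw [mul_eq_zero]
      right
      rw [← h1]
      exact Finset.sum_congr rfl fun t _ => by rw [inner_smul_right, mul_comm]
    have h2 := hinj (h0.trans (Matrix.mulVec_zero _).symm)
    exact congrFun h2 ⟨i, hi⟩
  obtain ⟨a, ha, horth⟩ := exists_latticeFilter_orthonormal hli hone hshift
  refine ⟨a, ha, fun t n => ?_⟩
  let M := innovationMatrix a n
  have hMm : Measurable M.mulVec :=
    (measurableEmbedding_mulVec (det_innovationMatrix_pos ha n).ne').measurable
  have hwin := hX.isGaussianProcess.hasGaussianLaw_comp fun i : Fin n => (0 : ℤ) + (i : ℕ)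
  -- Orthonormality is available for the errors of the window starting at time `0`; stationarity
  -- moves every window there.
  rw [hst.windowLaw_eq, windowLaw, Measure.map_map hMm (measurable_standardize m v),
    AEMeasurable.map_map_of_aemeasurable
      (hMm.comp (measurable_standardize m v)).aemeasurable (aemeasurable_window hm 0 n)]
  let W : Fin n → Ω → ℝ := fun j ω => ∑ i : Fin n, M j i * Y (i : ℕ) ω
  have hWeq : (M.mulVec ∘ standardize m v) ∘ (fun ω (i : Fin n) => X (0 + (i : ℕ)) ω) =
      fun ω j => W j ω := by
    funext ω j
    simp [Matrix.mulVec, dotProduct, W, Y, standardize]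
  rw [hWeq]
  have hterm : ∀ (j i : Fin n), MemLp (fun ω => M j i * Y (i : ℕ) ω) 2 P :=
    fun j i => (hY2 _).const_mul _
  refine map_eq_stdNormal ?_ (fun j => ?_) fun i j => ?_
  · rw [← hWeq]
    have h1 := HasGaussianLaw.clm_add_const hwin
      ((√v)⁻¹ • ContinuousLinearMap.id ℝ (Fin n → ℝ)) (fun _ => -((√v)⁻¹ * m))
    refine (h1.map_fun (Matrix.toLin' M).toContinuousLinearMap).congr
      (Filter.Eventually.of_forall fun ω => ?_)
    simp [standardize_eq_smul_add]
  · simp only [W]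
    rw [integral_finsetSum _ fun i _ => (hterm j i).integrable (by norm_num)]
    simp [integral_const_mul, hYmean]
  · have h := horth i j
    rw [← sum_innovationMatrix_smul a n V i, ← sum_innovationMatrix_smul a n V j, sum_inner] at h
    simp only [W]
    rw [covariance_fun_sum_fun_sum (hterm i) (hterm j)]
    simp only [covariance_const_mul_left, covariance_const_mul_right]
    simp only [inner_sum, real_inner_smul_left, real_inner_smul_right, hin, Fin.val_inj] at h
    exact h

theorem isSVineProcess_of_isNonsingularGaussianProcess [IsProbabilityMeasure P]
    (hst : IsStrictlyStationary X P) (hX : IsNonsingularGaussianProcess X P) :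
    IsSVineProcess X P := by
  have hm := hst.aemeasurable
  have hG := hX.isGaussianProcess.hasGaussianLaw_eval 0
  have hmarg := fun t => HasGaussianLaw.map_eq_of_identDistrib hG (hst.identDistrib t)
  have hv : (Var[X 0; P]).toNNReal ≠ 0 := fun h =>
    variance_ne_zero_of_absolutelyContinuous hG
      (absolutelyContinuous_map_of_windowLaw hm (hX.windowLaw_absolutelyContinuous 0 1) 0)
      (le_antisymm (Real.toNNReal_eq_zero.1 h) (variance_nonneg _ _))
  obtain ⟨a, ha, hwhite⟩ := exists_map_innovationMatrix_eq_stdNormal hst hX hv hmarg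
  -- The coefficient `a k` belongs to lag `k + 1`; the value at lag `0` is a dummy.
  let C : ℕ → Copula 2 := fun k => gaussianCopula (ha (k - 1))
  have hC : ∀ k, (C (k + 1)).law = (bivariateNormal (a k)).map stdCDFPi := fun k => rfl
  refine ⟨C, hst, fun k _ => isSmoothPositive_of_law_eq (ha (k - 1)) rfl,
    fun t n _ => hX.windowLaw_absolutelyContinuous t n, fun t n _ => ?_⟩
  have := isProbabilityMeasure_windowLaw hm t n
  have := Measure.isProbabilityMeasure_map (μ := windowLaw X P t n)
    (measurable_standardize (ι := Fin n) (∫ ω, X 0 ω ∂P) (Var[X 0; P]).toNNReal).aemeasurable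
  have hmargW := fun i => (map_eval_windowLaw hm t n i).trans (hmarg _)
  refine ⟨Copula.ofStdNormalMargins _ (map_standardize_eval hv hmargW),
    (Copula.isCopulaOf_iff hv hmargW _).2 rfl, fun D' hD' => Copula.ext_law
      ((Copula.isCopulaOf_iff hv hmargW D').1 hD'), ?_⟩
  rw [Copula.hasDensity_iff, ← (eq_withDensity_sVineDensity_iff ha hC _).2 (hwhite t n)]
  rfl

/-- The innovation matrix whitens the standardized window; undoing it, and then the standardization,
is an affine map of a standard normal vector. -/
theorem hasGaussianLaw_window_of_isSVineProcessWith [IsProbabilityMeasure P] {C : ℕ → Copula 2}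
    (h : IsSVineProcessWith X P C) (hC : ∀ k, 1 ≤ k → (C k).IsGaussian)
    (hX : ∀ t, HasGaussianLaw (X t) P) (t : ℤ) {n : ℕ} (hn : 2 ≤ n) :
    HasGaussianLaw (fun ω (i : Fin n) => X (t + (i : ℕ)) ω) P := by
  have hm := h.stationary.aemeasurable
  have hmarg := fun t => HasGaussianLaw.map_eq_of_identDistrib (hX 0) (h.stationary.identDistrib t)
  have hv : (Var[X 0; P]).toNNReal ≠ 0 := fun h0 =>
    variance_ne_zero_of_absolutelyContinuous (hX 0)
      (absolutelyContinuous_map_of_windowLaw hm (h.absolutelyContinuous 0 2 le_rfl) 0)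
      (le_antisymm (Real.toNNReal_eq_zero.1 h0) (variance_nonneg _ _))
  set m := ∫ ω, X 0 ω ∂P
  set v := (Var[X 0; P]).toNNReal
  have hs : √(v : ℝ) ≠ 0 := (Real.sqrt_pos.2 (by positivity)).ne'
  choose a ha hlaw using fun k => (hC (k + 1) k.succ_pos).exists_law_eq
  obtain ⟨D, hD, -, hdens⟩ := h.copula t n hn
  have := isProbabilityMeasure_windowLaw hm t n
  have hmargW := fun i => (map_eval_windowLaw hm t n i).trans (hmarg _)
  have h1 := (Copula.isCopulaOf_iff hv hmargW D).1 hD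
  rw [(Copula.hasDensity_iff D _).1 hdens] at h1
  -- Both sides are images under the embedding `stdCDFPi`; pulling back identifies the standardized
  -- window law itself.
  have h2 := congrArg (Measure.comap stdCDFPi) h1
  rw [measurableEmbedding_stdCDFPi.comap_map, measurableEmbedding_stdCDFPi.comap_map] at h2
  have h3 := (eq_withDensity_sVineDensity_iff ha hlaw _).1 h2.symm
  have hdet := (det_innovationMatrix_pos ha n).ne'
  set M := innovationMatrix a n
  have hMm : Measurable M.mulVec := (measurableEmbedding_mulVec hdet).measurable
  rw [windowLaw, Measure.map_map hMm (measurable_standardize m v),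
    AEMeasurable.map_map_of_aemeasurable
      (hMm.comp (measurable_standardize m v)).aemeasurable (aemeasurable_window hm t n)] at h3
  have hW : HasGaussianLaw ((M.mulVec ∘ standardize m v) ∘
      fun ω (i : Fin n) => X (t + (i : ℕ)) ω) P := ⟨by rw [h3]; infer_instance⟩
  refine (HasGaussianLaw.clm_add_const hW (√v • (Matrix.toLin' M⁻¹).toContinuousLinearMap)
    fun _ => m).congr (Filter.Eventually.of_forall fun ω => ?_)
  funext i
  simp only [Function.comp_apply, _root_.smul_apply, Pi.add_apply, Pi.smul_apply,
    LinearMap.coe_toContinuousLinearMap', Matrix.toLin'_apply, Matrix.mulVec_mulVec,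
    Matrix.nonsing_inv_mul M hdet.isUnit, Matrix.one_mulVec, standardize, smul_eq_mul]
  rw [mul_div_cancel₀ _ hs, sub_add_cancel]

theorem exists_window_of_finset (I : Finset ℤ) :
    ∃ (t : ℤ) (n : ℕ), 2 ≤ n ∧ ∀ i ∈ I, t ≤ i ∧ (i - t).toNat < n := by
  obtain ⟨b, hb⟩ := I.bddAbove
  obtain ⟨t, ht⟩ := I.bddBelow
  refine ⟨t, (b - t).toNat + 2, by omega, fun i hi => ?_⟩
  have h1 : t ≤ i := ht hi
  have h2 : i ≤ b := hb hi
  omega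

/-- Every finite set of times lies in a window, and selecting distinct coordinates is a surjective
linear map, which preserves Gaussianity and absolute continuity. -/
theorem isNonsingularGaussianProcess_of_windows (hX : ∀ t, AEMeasurable (X t) P)
    (hG : ∀ (t : ℤ) (n : ℕ), 2 ≤ n → HasGaussianLaw (fun ω (i : Fin n) => X (t + (i : ℕ)) ω) P)
    (hac : ∀ (t : ℤ) (n : ℕ), 2 ≤ n → windowLaw X P t n ≪ volume) :
    IsNonsingularGaussianProcess X P := by
  have key : ∀ I : Finset ℤ, HasGaussianLaw (fun ω => I.restrict (X · ω)) P ∧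
      P.map (fun ω => I.restrict (X · ω)) ≪ volume := fun I => by
    obtain ⟨t, n, hn, hI⟩ := exists_window_of_finset I
    let e : I → Fin n := fun i => ⟨(i - t).toNat, (hI i i.2).2⟩
    have he : ∀ i, t + ((e i : ℕ) : ℤ) = i := fun i => by
      have := (hI i i.2).1
      simp only [e]
      omega
    have hinj : Function.Injective e := fun i j hij => by
      apply Subtype.ext
      rw [← he i, ← he j, hij]
    have heq : (fun ω (i : I) => X (t + ((e i : ℕ) : ℤ)) ω) = fun ω => I.restrict (X · ω) := by
      funext ω i
      rw [he]; rfl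
    rw [← heq]
    exact ⟨(hG t n hn).map_fun (ContinuousLinearMap.pi fun i => ContinuousLinearMap.proj (e i)),
      absolutelyContinuous_map_comp_of_injective (aemeasurable_window hX t n) (hac t n hn) hinj⟩
  exact ⟨⟨fun I => (key I).1⟩,
    fun I => isUnit_covariance_of_absolutelyContinuous (key I).1 (key I).2, fun I => (key I).2⟩

end Processes

theorem mainTheorem3 {Ω : Type*} [MeasurableSpace Ω] (P : Measure Ω) [IsProbabilityMeasure P]
    (X : ℤ → Ω → ℝ) :
    (IsStrictlyStationary X P → IsNonsingularGaussianProcess X P → IsSVineProcess X P) ∧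
    (∀ C : ℕ → Copula 2, IsSVineProcessWith X P C →
      (∀ k, 1 ≤ k → (C k).IsGaussian) → (∀ t, HasGaussianLaw (X t) P) →
      IsNonsingularGaussianProcess X P) :=
  ⟨isSVineProcess_of_isNonsingularGaussianProcess, fun _ h hC hX =>
    isNonsingularGaussianProcess_of_windows h.stationary.aemeasurable
      (fun t _ hn => hasGaussianLaw_window_of_isSVineProcessWith h hC hX t hn)
      h.absolutelyContinuous⟩
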